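/- **Theorem.** Let $d\in\{2,3\}$, let $D_{\rm ref}\subset\mathbb R^d$ be a bounded domain with Lipschitz boundary, $U:=[0,1]^{\mathbb N}$ with the product $d\boldsymbol y$ of the Lebesgue measures, and let $\psi_i:\overline{D_{\rm ref}}\to\mathbb R^d$, $i\in\mathbb N$. Put $$V(x,y):=x+\tfrac1{\sqrt6}\sum_{i\ge1}\sin(2\pi y_i)\,\psi_i(x),\qquad J(x,y):=I+\tfrac1{\sqrt6}\sum_{i\ge1}\sin(2\pi y_i)\,\psi_i'(x),$$ $D(y):=V(D_{\rm ref},y)$ and $\mathcal D:=\bigcup_{y\in U}D(y)$. For vector fields let $\|v\|_{W^{1,\infty}(D_{\rm ref})}:=\max(\operatorname{ess\,sup}_{D_{\rm ref}}\|v(x)\|_2,\operatorname{ess\,sup}_{D_{\rm ref}}\|v'(x)\|_2)$ (Euclidean and spectral norm) and $\|v\|_{C^2(\overline D)}:=\max_{|\nu|\le2}\sup_{x\in\overline D}\|\partial^\nu v(x)\|_2$. Assume: * (A1) for each $y\in U$, $V(\cdot,y):\overline{D_{\rm ref}}\to\mathbb R^d$ is invertible (onto its image) and twice continuously differentiable;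 * (A2) there is $C>0$ such that $V^{-1}(\cdot,y)$ is twice continuously differentiable on $\overline{D(y)}$, $\|V(\cdot,y)\|_{C^2(\overline{D_{\rm ref}})}\le C$ and $\|V^{-1}(\cdot,y)\|_{C^2(\overline{D(y)})}\le C$ for all $y\in U$; * (A3) there are constants $0<\sigma_{\min}\le1\le\sigma_{\max}<\infty$ such that all singular values of $J(x,y)$ lie in $[\sigma_{\min},\sigma_{\max}]$ for all $x\in D_{\rm ref}$, $y\in U$; * (A4) $\|\psi_i\|_{W^{1,\infty}(D_{\rm ref})}<\infty$ for all $i$ and $\sum_{i\ge1}\|\psi_i\|_{W^{1,\infty}(D_{\rm ref})}<\infty$; * (A5) $\sum_{i\ge1}\|\psi_i\|_{W^{1,\infty}(D_{\rm ref})}^p<\infty$, where $p\in(0,1)$; * (A6) $\|\psi_1\|_{W^{1,\infty}(D_{\rm ref})}\ge\|\psi_2\|_{W^{1,\infty}(D_{\rm ref})}\ge\cdots$. Let $f$ be real-analytic on (a neighbourhood of) the closure of $\mathcal D$. Put $A:=(J^\top J)^{-1}\det J$ and $f_{\rm ref}(x,y):=f(V(x,y))\det J(x,y)$. Then for every $y\in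 U$ there is exactly one $\widehat u(\cdot,y)\in H_0^1(D_{\rm ref})$ with $$\int_{D_{\rm ref}}(A(x,y)\nabla\widehat u(x,y))\cdot\nabla\widehat v(x)\,dx=\int_{D_{\rm ref}}f_{\rm ref}(x,y)\,\widehat v(x)\,dx\qquad\text{for all }\widehat v\in H_0^1(D_{\rm ref}).$$ Set $\widehat u_s(\cdot,y):=\widehat u(\cdot,(y_1,\dots,y_s,0,0,\dots))$. Then $\widehat u$ and all $\widehat u_s$ are Bochner integrable over $U$ with values in $H_0^1(D_{\rm ref})$, and there is a constant $C$, independent of $s$, such that for all integers $s\ge1$ $$\Big\|\int_U(\widehat u(\cdot,y)-\widehat u_s(\cdot,y))\,d\boldsymbol y\Big\|_{H_0^1(D_{\rm ref})}\le C\,s^{-2/p+1}\quad\text{and}\quad\Big\|\int_U(\widehat u(\cdot,y)-\widehat u_s(\cdot,y))\,d\boldsymbol y\Big\|_{L^1(D_{\rm ref})}\le C\,s^{-2/p+1},$$ where $\|v\|_{H_0^1(D_{\rm ref})}:=\|\nabla v\|_{L^2(D_{\rm ref})}$. -/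

import Mathlib

open MeasureTheory
open scoped ENNReal NNReal Matrix ContDiff

noncomputable section

namespace DomainUQ

variable {d : ℕ}

/-! ### Domains -/

/-- Every boundary point has a neighbourhood in which `Ω` is the strict epigraph, in some
orthonormal direction `n`, of a Lipschitz function of the orthogonal variables. -/
def HasLipschitzBoundary (Ω : Set (EuclideanSpace ℝ (Fin d))) : Prop :=
  ∀ x ∈ frontier Ω, ∃ n : EuclideanSpace ℝ (Fin d), ‖n‖ = 1 ∧
    ∃ (K : ℝ≥0) (γ : EuclideanSpace ℝ (Fin d) → ℝ), LipschitzWith K γ ∧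
      ∃ O ∈ nhds x, ∀ z ∈ O, z ∈ Ω ↔ γ (z - inner ℝ n z • n) < inner ℝ n z

/-- A bounded domain (nonempty, open and connected) with Lipschitz boundary. -/
structure IsBoundedLipschitzDomain (Ω : Set (EuclideanSpace ℝ (Fin d))) : Prop where
  isOpen : IsOpen Ω
  isConnected : IsConnected Ω
  isBounded : Bornology.IsBounded Ω
  lipschitz : HasLipschitzBoundary Ω

/-! ### Norms of vector fields -/

/-- The Jacobian matrix `(∂g_i / ∂x_j)` of a vector field. -/
def jacobian (g : EuclideanSpace ℝ (Fin d) → EuclideanSpace ℝ (Fin d))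
    (x : EuclideanSpace ℝ (Fin d)) : Matrix (Fin d) (Fin d) ℝ :=
  Matrix.of fun i j => fderiv ℝ g x (EuclideanSpace.single j 1) i

/-- The set of the `d` singular values of a `d × d` matrix. -/
def singularValues (M : Matrix (Fin d) (Fin d) ℝ) : Set ℝ :=
  {t | ∃ i : Fin d, (Matrix.toEuclideanLin M).singularValues i = t}

/-- The norm `‖g‖_{W^{1,∞}(Ω)} = max (ess sup ‖g(x)‖₂, ess sup ‖g'(x)‖₂)` of a (classically
differentiable) vector field on the open set `Ω`; the operator norm of `fderiv` is the spectral norm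
of the Jacobian matrix. -/
def wOneInftyNorm (Ω : Set (EuclideanSpace ℝ (Fin d)))
    (g : EuclideanSpace ℝ (Fin d) → EuclideanSpace ℝ (Fin d)) : ℝ≥0∞ :=
  max (eLpNorm g ⊤ (volume.restrict Ω)) (eLpNorm (fderiv ℝ g) ⊤ (volume.restrict Ω))

/-- The norm `‖g‖_{C^k(K)} = max_{|ν| ≤ k} sup_{x ∈ K} ‖∂^ν g(x)‖` of a vector field on a set `K`
(the closure of a domain).  A partial derivative of order `j` is the `j`-th derivative evaluated
on `j` coordinate vectors. -/
def cNorm (k : ℕ) (K : Set (EuclideanSpace ℝ (Fin d)))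
    (g : EuclideanSpace ℝ (Fin d) → EuclideanSpace ℝ (Fin d)) : ℝ≥0∞ :=
  ⨆ (j : ℕ) (_ : j ≤ k) (idx : Fin j → Fin d) (x ∈ K),
    ‖iteratedFDerivWithin ℝ j g K x (fun l => EuclideanSpace.single (idx l) (1 : ℝ))‖ₑ

/-! ### The parameter set and the random perturbation field -/

/-- The parameter set `U = [0,1]^ℕ`. -/
abbrev ParamSet : Type := ℕ → unitInterval

/-- The uniform probability measure on `U`, i.e. the countable product of Lebesgue measures. -/
def paramMeasure : Measure ParamSet :=
  Measure.infinitePi fun _ : ℕ => (volume : Measure unitInterval)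

/-- `(y_1, y_2, …) ↦ (y_1, …, y_s, 0, 0, …)`; indices start from `0` here. -/
def truncate (s : ℕ) (y : ParamSet) : ParamSet := fun i => if i < s then y i else 0

/-- `V(x,y) = x + 6^{-1/2} ∑ sin(2π y_i) ψ_i(x)`. -/
def field (ψ : ℕ → EuclideanSpace ℝ (Fin d) → EuclideanSpace ℝ (Fin d))
    (y : ParamSet) (x : EuclideanSpace ℝ (Fin d)) : EuclideanSpace ℝ (Fin d) :=
  x + (1 / √6 : ℝ) • ∑' i, Real.sin (2 * Real.pi * (y i : ℝ)) • ψ i x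

/-- `J(x,y) = I + 6^{-1/2} ∑ sin(2π y_i) ψ_i'(x)`. -/
def fieldJacobian (ψ : ℕ → EuclideanSpace ℝ (Fin d) → EuclideanSpace ℝ (Fin d))
    (y : ParamSet) (x : EuclideanSpace ℝ (Fin d)) : Matrix (Fin d) (Fin d) ℝ :=
  1 + (1 / √6 : ℝ) • ∑' i, Real.sin (2 * Real.pi * (y i : ℝ)) • jacobian (ψ i) x

/-- The admissible domain `D(y) = V(D_ref, y)`. -/
def admissibleDomain (Dref : Set (EuclideanSpace ℝ (Fin d)))
    (ψ : ℕ → EuclideanSpace ℝ (Fin d) → EuclideanSpace ℝ (Fin d)) (y : ParamSet) :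
    Set (EuclideanSpace ℝ (Fin d)) :=
  field ψ y '' Dref

/-- The hold-all domain, the union of all admissible domains. -/
def holdAll (Dref : Set (EuclideanSpace ℝ (Fin d)))
    (ψ : ℕ → EuclideanSpace ℝ (Fin d) → EuclideanSpace ℝ (Fin d)) :
    Set (EuclideanSpace ℝ (Fin d)) :=
  ⋃ y : ParamSet, admissibleDomain Dref ψ y

/-- The inverse `V⁻¹(·,y) : closure D(y) → closure D_ref`
(`closure D(y) = V(closure D_ref, y)`). -/
def fieldInv (Dref : Set (EuclideanSpace ℝ (Fin d)))
    (ψ : ℕ → EuclideanSpace ℝ (Fin d) → EuclideanSpace ℝ (Fin d)) (y : ParamSet) :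
    EuclideanSpace ℝ (Fin d) → EuclideanSpace ℝ (Fin d) :=
  Function.invFunOn (field ψ y) (closure Dref)

/-! ### Assumptions on the parameterization -/

/-- Each `V(·,y) : closure D_ref → ℝ^d` is invertible and twice continuously differentiable. -/
def FieldRegular (Dref : Set (EuclideanSpace ℝ (Fin d)))
    (ψ : ℕ → EuclideanSpace ℝ (Fin d) → EuclideanSpace ℝ (Fin d)) : Prop :=
  ∀ y : ParamSet, Set.InjOn (field ψ y) (closure Dref) ∧
    ContDiffOn ℝ 2 (field ψ y) (closure Dref)

/-- `V(·,y)` and its inverse are bounded in `C²`, uniformly in `y`. -/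
def FieldUniformC2 (Dref : Set (EuclideanSpace ℝ (Fin d)))
    (ψ : ℕ → EuclideanSpace ℝ (Fin d) → EuclideanSpace ℝ (Fin d)) : Prop :=
  ∃ C : ℝ≥0, 0 < C ∧ ∀ y : ParamSet,
    cNorm 2 (closure Dref) (field ψ y) ≤ C ∧
    ContDiffOn ℝ 2 (fieldInv Dref ψ y) (closure (admissibleDomain Dref ψ y)) ∧
    cNorm 2 (closure (admissibleDomain Dref ψ y)) (fieldInv Dref ψ y) ≤ C

/-- The singular values of `J(x,y)` are bounded above and away from zero, uniformly. -/
def JacobianUniformlyBounded (Dref : Set (EuclideanSpace ℝ (Fin d)))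
    (ψ : ℕ → EuclideanSpace ℝ (Fin d) → EuclideanSpace ℝ (Fin d)) : Prop :=
  ∃ σmin σmax : ℝ, 0 < σmin ∧ σmin ≤ 1 ∧ 1 ≤ σmax ∧
    ∀ x ∈ Dref, ∀ y : ParamSet, ∀ t ∈ singularValues (fieldJacobian ψ y x),
      σmin ≤ t ∧ t ≤ σmax

/-- The fluctuations are absolutely summable in `W^{1,∞}`. -/
def FluctuationsSummable (Dref : Set (EuclideanSpace ℝ (Fin d)))
    (ψ : ℕ → EuclideanSpace ℝ (Fin d) → EuclideanSpace ℝ (Fin d)) : Prop :=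
  (∀ i, wOneInftyNorm Dref (ψ i) < ⊤) ∧ ∑' i, wOneInftyNorm Dref (ψ i) < ⊤

/-- The `W^{1,∞}` norms of the fluctuations are `p`-summable. -/
def FluctuationsPSummable (Dref : Set (EuclideanSpace ℝ (Fin d)))
    (ψ : ℕ → EuclideanSpace ℝ (Fin d) → EuclideanSpace ℝ (Fin d)) (p : ℝ) : Prop :=
  ∑' i, wOneInftyNorm Dref (ψ i) ^ p < ⊤

/-- The `W^{1,∞}` norms of the fluctuations are non-increasing. -/
def FluctuationsOrdered (Dref : Set (EuclideanSpace ℝ (Fin d)))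
    (ψ : ℕ → EuclideanSpace ℝ (Fin d) → EuclideanSpace ℝ (Fin d)) : Prop :=
  Antitone fun i => wOneInftyNorm Dref (ψ i)

/-! ### The Sobolev space `H_0^1` -/

/-- Smooth functions with compact support in `Ω`. -/
structure IsTestFunction (Ω : Set (EuclideanSpace ℝ (Fin d)))
    (φ : EuclideanSpace ℝ (Fin d) → ℝ) : Prop where
  smooth : ContDiff ℝ ∞ φ
  compact : HasCompactSupport φ
  support : tsupport φ ⊆ Ω

/-- The Hilbert space `L²(Ω) × L²(Ω; ℝ^d)`. -/
abbrev L2Pair (Ω : Set (EuclideanSpace ℝ (Fin d))) : Type :=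
  WithLp 2 (Lp ℝ 2 (volume.restrict Ω) × Lp (EuclideanSpace ℝ (Fin d)) 2 (volume.restrict Ω))

/-- The pairs `(φ, ∇φ)` in `L²(Ω) × L²(Ω; ℝ^d)` with `φ` a test function. -/
def testPairs (Ω : Set (EuclideanSpace ℝ (Fin d))) : Submodule ℝ (L2Pair Ω) where
  carrier := {w | ∃ φ : EuclideanSpace ℝ (Fin d) → ℝ, IsTestFunction Ω φ ∧
    w.fst =ᵐ[volume.restrict Ω] φ ∧ w.snd =ᵐ[volume.restrict Ω] gradient φ}
  zero_mem' := by
    refine ⟨0, ⟨contDiff_const, HasCompactSupport.zero, by simp⟩, Lp.coeFn_zero _ _ _, ?_⟩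
    filter_upwards [Lp.coeFn_zero (EuclideanSpace ℝ (Fin d)) 2 (volume.restrict Ω)] with x hx
    change ((0 : Lp (EuclideanSpace ℝ (Fin d)) 2 (volume.restrict Ω)) :
      EuclideanSpace ℝ (Fin d) → EuclideanSpace ℝ (Fin d)) x = _
    rw [hx]
    simp [gradient]
  add_mem' := by
    rintro a b ⟨φ, hφ, ha₁, ha₂⟩ ⟨χ, hχ, hb₁, hb₂⟩
    refine ⟨φ + χ, ⟨hφ.smooth.add hχ.smooth, hφ.compact.add hχ.compact, ?_⟩, ?_, ?_⟩
    · exact (tsupport_add φ χ).trans (Set.union_subset hφ.support hχ.support)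
    · filter_upwards [Lp.coeFn_add a.fst b.fst, ha₁, hb₁] with x h h₁ h₂
      rw [WithLp.add_fst, h, Pi.add_apply, Pi.add_apply, h₁, h₂]
    · filter_upwards [Lp.coeFn_add a.snd b.snd, ha₂, hb₂] with x h h₁ h₂
      rw [WithLp.add_snd, h, Pi.add_apply, h₁, h₂]
      simp only [gradient]
      rw [fderiv_add ((hφ.smooth.differentiable (by simp)) x)
        ((hχ.smooth.differentiable (by simp)) x), map_add]
  smul_mem' := by
    rintro c a ⟨φ, hφ, ha₁, ha₂⟩
    refine ⟨c • φ, ⟨hφ.smooth.const_smul c, ?_, ?_⟩, ?_, ?_⟩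
    · exact hφ.compact.mono (Function.support_const_smul_subset c φ)
    · exact (closure_mono (Function.support_const_smul_subset c φ)).trans hφ.support
    · filter_upwards [Lp.coeFn_smul c a.fst, ha₁] with x h h₁
      rw [WithLp.smul_fst, h, Pi.smul_apply, Pi.smul_apply, h₁]
    · filter_upwards [Lp.coeFn_smul c a.snd, ha₂] with x h h₁
      rw [WithLp.smul_snd, h, Pi.smul_apply, h₁]
      simp only [gradient]
      rw [fderiv_const_smul ((hφ.smooth.differentiable (by simp)) x), map_smulₛₗ]
      simp

/-- `H_0^1(Ω)`, the closure of the test functions in the `H^1` norm.  An element is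
represented by the pair of a function in `L²(Ω)` and its weak gradient (which is determined by
the function). -/
abbrev H01 (Ω : Set (EuclideanSpace ℝ (Fin d))) : Type := (testPairs Ω).topologicalClosure

/-- The underlying function of an element of `H_0^1(Ω)`. -/
def H01.fn {Ω : Set (EuclideanSpace ℝ (Fin d))} (u : H01 Ω) : Lp ℝ 2 (volume.restrict Ω) :=
  (u : L2Pair Ω).fst

/-- The weak gradient of an element of `H_0^1(Ω)`. -/
def H01.grad {Ω : Set (EuclideanSpace ℝ (Fin d))} (u : H01 Ω) :
    Lp (EuclideanSpace ℝ (Fin d)) 2 (volume.restrict Ω) :=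
  (u : L2Pair Ω).snd

/-- The norm `‖v‖_{H_0^1(Ω)} = ‖∇v‖_{L²(Ω)}`. -/
def H01.h01Norm {Ω : Set (EuclideanSpace ℝ (Fin d))} (u : H01 Ω) : ℝ := ‖H01.grad u‖

/-- The norm `‖v‖_{L¹(Ω)}`. -/
def H01.l1Norm {Ω : Set (EuclideanSpace ℝ (Fin d))} (u : H01 Ω) : ℝ :=
  ∫ x in Ω, |H01.fn u x|

/-! ### The transported problem on the reference domain -/

/-- The transport coefficient `A = B⁻¹ det J` with `B = Jᵀ J`. -/
def transportCoeff (ψ : ℕ → EuclideanSpace ℝ (Fin d) → EuclideanSpace ℝ (Fin d))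
    (y : ParamSet) (x : EuclideanSpace ℝ (Fin d)) : Matrix (Fin d) (Fin d) ℝ :=
  (fieldJacobian ψ y x).det • ((fieldJacobian ψ y x)ᵀ * fieldJacobian ψ y x)⁻¹

/-- The transported source term `f_ref(x,y) = f(V(x,y)) det J(x,y)`. -/
def refSource (ψ : ℕ → EuclideanSpace ℝ (Fin d) → EuclideanSpace ℝ (Fin d))
    (f : EuclideanSpace ℝ (Fin d) → ℝ) (y : ParamSet) (x : EuclideanSpace ℝ (Fin d)) : ℝ :=
  f (field ψ y x) * (fieldJacobian ψ y x).det

/-- `u ∈ H_0^1(D_ref)` solves the transported variational problem for the parameter `y`. -/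
def IsWeakSolution (Dref : Set (EuclideanSpace ℝ (Fin d)))
    (ψ : ℕ → EuclideanSpace ℝ (Fin d) → EuclideanSpace ℝ (Fin d))
    (f : EuclideanSpace ℝ (Fin d) → ℝ) (y : ParamSet) (u : H01 Dref) : Prop :=
  ∀ v : H01 Dref,
    ∫ x in Dref, (transportCoeff ψ y x *ᵥ (H01.grad u x).ofLp) ⬝ᵥ (H01.grad v x).ofLp =
      ∫ x in Dref, refSource ψ f y x * H01.fn v x

end DomainUQ

end

/-! # Dimension truncation for the periodic domain mapping model

The parameters enter only through `z_i = sin (2 π y_i)`, and `V(x,y)`, `J(x,y)` are affine functions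
of `z ∈ [-1,1]^ℕ`.  The proof estimates the effect of switching on one parameter at a time.

* For fixed `x` the pairs `(V(x,y), J(x,y))` form a convex set
  (`DomainUQ.segment_fieldJet_subset`) inside a fixed compact set on which `f` and the map
  `M ↦ (Mᵀ M)⁻¹ det M` are smooth (`DomainUQ.exists_fieldJet_mem`); the sign of `det J` is constant
  along the segment to the identity.  The mean value theorem along segments then bounds first and
  second differences of the transported coefficient and source by `t` and `t²`, where `t` is the
  distance of the parameters weighted by `b_i = ‖ψ_i‖_{W^{1,∞}}`
  (`DomainUQ.exists_bounds_transported_data`).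
* The coefficient is uniformly elliptic by compactness, and the Poincaré inequality
  (`DomainUQ.exists_poincare`) makes the energy forms uniformly coercive on `H_0^1`.  This gives
  unique solvability by Lax-Milgram (`DomainUQ.existsUnique_weakSolution`), and an elementary
  perturbation identity transfers the difference bounds from the data to the solutions
  (`DomainUQ.exists_bound_differences_of_coercive`).
* Let `u_i` be the solution truncated after `i` parameters.  The reflection `y_i ↦ 1 - y_i` preserves
  the measure and replaces `z_i` by `-z_i`, so the mean of `u_{i+1} - u_i` is half the mean of a
  symmetric second difference, of size `O(b_i²)`.  Telescoping bounds the mean of `u - u_s` by a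
  multiple of `∑_{i ≥ s} b_i²` (`DomainUQ.norm_integral_sub_truncate_le`), which is
  `O(s^{-2/p+1})` for a non-increasing `p`-summable sequence (`DomainUQ.exists_sum_sq_le_rpow`).

In this form the argument needs no derivatives of the solution in the parameters, and second order
regularity of the data is enough. -/

namespace DomainUQ

/-! ### First and second differences of smooth maps -/

/-- A `C²` map on a compact set has first differences of first order and symmetric second
differences of second order, with one constant for all segments inside the set. -/
theorem exists_bound_first_second_difference {E F : Type*} [NormedAddCommGroup E]
    [NormedSpace ℝ E] [NormedAddCommGroup F] [NormedSpace ℝ F] {K : Set E} (hK : IsCompact K)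
    {g : E → F} (hg : ∀ x ∈ K, ContDiffAt ℝ 2 g x) :
    ∃ C, 0 ≤ C ∧ ∀ p q, segment ℝ p q ⊆ K → ‖g p - g q‖ ≤ C * ‖p - q‖ ∧
      ‖g p + g q - (2 : ℝ) • g (midpoint ℝ p q)‖ ≤ C * ‖p - q‖ ^ 2 := by
  have hg1 : ∀ x ∈ K, ContDiffAt ℝ 1 (fderiv ℝ g) x := fun x hx =>
    (hg x hx).fderiv_right (by norm_num)
  have hg2 : ∀ x ∈ K, ContDiffAt ℝ 0 (fderiv ℝ (fderiv ℝ g)) x := fun x hx =>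
    (hg1 x hx).fderiv_right (by norm_num)
  obtain ⟨C₁, hC₁⟩ := hK.exists_bound_of_continuousOn (f := fderiv ℝ g)
    fun x hx => (hg1 x hx).continuousAt.continuousWithinAt
  obtain ⟨C₂, hC₂⟩ := hK.exists_bound_of_continuousOn (f := fderiv ℝ (fderiv ℝ g))
    fun x hx => (hg2 x hx).continuousAt.continuousWithinAt
  refine ⟨max (max C₁ C₂) 0, le_max_right _ _, fun p q hpq => ⟨?_, ?_⟩⟩
  · have h := (convex_segment p q).norm_image_sub_le_of_norm_fderiv_le (𝕜 := ℝ) (f := g)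
      (fun x hx => (hg x (hpq hx)).differentiableAt (by norm_num))
      (fun x hx => hC₁ x (hpq hx)) (right_mem_segment ℝ p q) (left_mem_segment ℝ p q)
    refine h.trans ?_
    gcongr
    exact (le_max_left _ _).trans (le_max_left _ _)
  -- `x ↦ g x + g (p + q - x)` has derivative `O(‖p - q‖)` between the midpoint and `p`.
  have hsym : ∀ x ∈ segment ℝ p q, p + q - x ∈ segment ℝ p q := by
    rintro x ⟨a, b, ha, hb, hab, rfl⟩
    refine ⟨b, a, hb, ha, by rw [add_comm]; exact hab, ?_⟩
    have : p + q = (a + b) • p + (a + b) • q := by rw [hab, one_smul, one_smul]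
    rw [this]
    module
  have hmid : midpoint ℝ p q ∈ segment ℝ p q := midpoint_mem_segment p q
  have hd : ∀ x ∈ segment ℝ p q, HasFDerivAt (fun x => g x + g (p + q - x))
      (fderiv ℝ g x - fderiv ℝ g (p + q - x)) x := by
    intro x hx
    have h1 := ((hg x (hpq hx)).differentiableAt (by norm_num)).hasFDerivAt
    have h2 := ((hg _ (hpq (hsym x hx))).differentiableAt (by norm_num)).hasFDerivAt
    have h3 : HasFDerivAt (fun x => p + q - x) (-ContinuousLinearMap.id ℝ E) x :=
      (hasFDerivAt_id x).const_sub (p + q)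
    have h4 := h1.add (h2.comp x h3)
    refine h4.congr_fderiv ?_
    ext v
    simp [sub_eq_add_neg]
  have hb : ∀ x ∈ segment ℝ p q, ‖fderiv ℝ g x - fderiv ℝ g (p + q - x)‖ ≤
      max (max C₁ C₂) 0 * ‖p - q‖ := by
    intro x hx
    have h := (convex_segment p q).norm_image_sub_le_of_norm_fderiv_le (𝕜 := ℝ)
      (f := fderiv ℝ g)
      (fun x hx => (hg1 x (hpq hx)).differentiableAt (by norm_num))
      (fun x hx => hC₂ x (hpq hx)) (hsym x hx) hx
    have h5 : ‖x - (p + q - x)‖ ≤ ‖p - q‖ := by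
      obtain ⟨a, b, ha, hb, hab, rfl⟩ := hx
      have : a • p + b • q - (p + q - (a • p + b • q)) = (a - b) • (p - q) := by
        have : p + q = (a + b) • p + (a + b) • q := by rw [hab, one_smul, one_smul]
        rw [this]
        module
      rw [this, norm_smul]
      refine mul_le_of_le_one_left (norm_nonneg _) ?_
      rw [Real.norm_eq_abs, abs_le]
      constructor <;> linarith
    refine h.trans ?_
    gcongr
    exact (le_max_right _ _).trans (le_max_left _ _)
  have h := (convex_segment p q).norm_image_sub_le_of_norm_hasFDerivWithin_le (𝕜 := ℝ)
    (fun x hx => (hd x hx).hasFDerivWithinAt) hb hmid (left_mem_segment ℝ p q)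
  have h6 : p + q - midpoint ℝ p q = midpoint ℝ p q := by
    rw [midpoint_eq_smul_add, invOf_eq_inv]
    module
  have h7 : ‖p - midpoint ℝ p q‖ ≤ ‖p - q‖ := by
    have : p - midpoint ℝ p q = (2⁻¹ : ℝ) • (p - q) := by
      rw [midpoint_eq_smul_add, invOf_eq_inv]
      module
    rw [this, norm_smul]
    refine mul_le_of_le_one_left (norm_nonneg _) ?_
    norm_num
  simp only [h6, add_sub_cancel_left] at h
  rw [two_smul]
  calc _ ≤ _ := h
    _ ≤ max (max C₁ C₂) 0 * ‖p - q‖ * ‖p - q‖ := by gcongr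
    _ = _ := by ring

/-! ### The transport coefficient as a function of the Jacobian matrix -/

variable {d : ℕ}

/-- The map `M ↦ (Mᵀ M)⁻¹ det M` from Jacobian matrices to transport coefficients.  Matrices are
written as plain functions of two indices, so that they carry the entrywise sup norm. -/
noncomputable def coeffOfJacobian (a : Fin d → Fin d → ℝ) : Fin d → Fin d → ℝ :=
  fun i j => ((Matrix.of a).det • ((Matrix.of a)ᵀ * Matrix.of a)⁻¹) i j

theorem contDiff_det {E : Type*} [NormedAddCommGroup E] [NormedSpace ℝ E] {n : WithTop ℕ∞}
    {M : E → Matrix (Fin d) (Fin d) ℝ} (hM : ∀ i j, ContDiff ℝ n fun x => M x i j) :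
    ContDiff ℝ n fun x => (M x).det := by
  simp_rw [Matrix.det_apply']
  exact ContDiff.sum fun σ _ => contDiff_const.mul (contDiff_prod fun i _ => hM _ _)

theorem contDiff_entry {n : WithTop ℕ∞} (i j : Fin d) :
    ContDiff ℝ n fun a : Fin d → Fin d → ℝ => a i j := by fun_prop

theorem contDiff_adjugate {E : Type*} [NormedAddCommGroup E] [NormedSpace ℝ E] {n : WithTop ℕ∞}
    {M : E → Matrix (Fin d) (Fin d) ℝ} (hM : ∀ i j, ContDiff ℝ n fun x => M x i j) (i j : Fin d) :
    ContDiff ℝ n fun x => (M x).adjugate i j := by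
  simp_rw [Matrix.adjugate_apply]
  refine contDiff_det fun k l => ?_
  by_cases h : k = j
  · subst h
    simpa using contDiff_const
  · simpa [Matrix.updateRow_ne h] using hM k l

theorem contDiffAt_coeffOfJacobian {n : WithTop ℕ∞} {a : Fin d → Fin d → ℝ}
    (ha : (Matrix.of a).det ≠ 0) :
    ContDiffAt ℝ n (coeffOfJacobian (d := d)) a := by
  have hgram : ∀ i j, ContDiff ℝ n fun b : Fin d → Fin d → ℝ =>
      ((Matrix.of b)ᵀ * Matrix.of b) i j := by
    intro i j
    simp only [Matrix.mul_apply, Matrix.transpose_apply, Matrix.of_apply]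
    exact ContDiff.sum fun k _ => (contDiff_entry _ _).mul (contDiff_entry _ _)
  refine contDiffAt_pi.2 fun i => contDiffAt_pi.2 fun j => ?_
  simp only [coeffOfJacobian, Matrix.smul_apply, Matrix.inv_def, Ring.inverse_eq_inv', smul_eq_mul]
  refine (contDiff_det fun _ _ => contDiff_entry _ _).contDiffAt.mul
    (ContDiffAt.mul (ContDiffAt.inv (contDiff_det hgram).contDiffAt ?_)
      (contDiff_adjugate hgram i j).contDiffAt)
  rw [Matrix.det_mul, Matrix.det_transpose]
  exact mul_ne_zero ha ha

/-- Matrices with entries bounded by `R` and determinant at least `δ`. -/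
def boundedMatrices (d : ℕ) (R δ : ℝ) : Set (Fin d → Fin d → ℝ) :=
  {a | (∀ i j, |a i j| ≤ R) ∧ δ ≤ (Matrix.of a).det}

theorem isCompact_boundedMatrices (R δ : ℝ) : IsCompact (boundedMatrices d R δ) := by
  have h1 : IsCompact {a : Fin d → Fin d → ℝ | ∀ i j, |a i j| ≤ R} := by
    have := isCompact_univ_pi (ι := Fin d) (X := fun _ => Fin d → ℝ)
      (s := fun _ => Set.univ.pi fun _ => Set.Icc (-R) R)
      fun _ => isCompact_univ_pi fun _ => isCompact_Icc
    convert this using 1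
    ext a
    simp [Pi.le_def, forall_and, abs_le]
  exact h1.inter_right (isClosed_le continuous_const
    (contDiff_det (n := 0) fun _ _ => contDiff_entry _ _).continuous)

/-- Uniform ellipticity of the transport coefficient: `ξ · (Mᵀ M)⁻¹ ξ det M` is continuous and
positive on a compact set of matrices times the unit sphere. -/
theorem exists_coercive_coeffOfJacobian (R : ℝ) {δ : ℝ} (hδ : 0 < δ) :
    ∃ c > 0, ∀ a ∈ boundedMatrices d R δ, ∀ ξ : EuclideanSpace ℝ (Fin d),
      c * ‖ξ‖ ^ 2 ≤ (Matrix.of (coeffOfJacobian a) *ᵥ ξ.ofLp) ⬝ᵥ ξ.ofLp := by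
  set q : (Fin d → Fin d → ℝ) × EuclideanSpace ℝ (Fin d) → ℝ := fun w =>
    (Matrix.of (coeffOfJacobian w.1) *ᵥ w.2.ofLp) ⬝ᵥ w.2.ofLp with hq
  have hdet : ∀ a ∈ boundedMatrices d R δ, (Matrix.of a).det ≠ 0 := fun a ha =>
    (hδ.trans_le ha.2).ne'
  have hK : IsCompact (boundedMatrices d R δ ×ˢ
      Metric.sphere (0 : EuclideanSpace ℝ (Fin d)) 1) :=
    (isCompact_boundedMatrices R δ).prod (isCompact_sphere _ _)
  have hcont : ContinuousOn q (boundedMatrices d R δ ×ˢ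
      Metric.sphere (0 : EuclideanSpace ℝ (Fin d)) 1) := by
    have h1 : ContinuousOn (fun w : (Fin d → Fin d → ℝ) × EuclideanSpace ℝ (Fin d) =>
        coeffOfJacobian w.1) (boundedMatrices d R δ ×ˢ
          Metric.sphere (0 : EuclideanSpace ℝ (Fin d)) 1) := by
      rintro ⟨a, ξ⟩ hw
      have h2 := (contDiffAt_coeffOfJacobian (n := 0) (hdet a hw.1)).continuousAt
      exact (ContinuousAt.comp (f := Prod.fst) (x := (a, ξ)) h2
        continuousAt_fst).continuousWithinAt
    simp only [hq, Matrix.mulVec, dotProduct, Matrix.of_apply]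
    have h3 : ∀ i j, ContinuousOn (fun w : (Fin d → Fin d → ℝ) × EuclideanSpace ℝ (Fin d) =>
        coeffOfJacobian w.1 i j) (boundedMatrices d R δ ×ˢ
          Metric.sphere (0 : EuclideanSpace ℝ (Fin d)) 1) := fun i j =>
      continuousOn_pi.1 (continuousOn_pi.1 h1 i) j
    have h4 : ∀ i, ContinuousOn (fun w : (Fin d → Fin d → ℝ) × EuclideanSpace ℝ (Fin d) =>
        w.2.ofLp i) (boundedMatrices d R δ ×ˢ
          Metric.sphere (0 : EuclideanSpace ℝ (Fin d)) 1) := fun i => by fun_prop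
    exact continuousOn_finsetSum _ fun i _ =>
      (continuousOn_finsetSum _ fun j _ => (h3 i j).mul (h4 j)).mul (h4 i)
  have hpos : ∀ w ∈ boundedMatrices d R δ ×ˢ
      Metric.sphere (0 : EuclideanSpace ℝ (Fin d)) 1, 0 < q w := by
    rintro ⟨a, ξ⟩ ⟨ha, hξ⟩
    have hd := hdet a ha
    have hunit : IsUnit (Matrix.of a) := (Matrix.isUnit_iff_isUnit_det _).2 hd.isUnit
    have hpd : (((Matrix.of a)ᵀ * Matrix.of a)⁻¹).PosDef := by
      have := (Matrix.PosDef.conjTranspose_mul_self (Matrix.of a)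
        (Matrix.mulVec_injective_iff_isUnit.2 hunit)).inv
      simpa using this
    have hξ0 : ξ.ofLp ≠ 0 := by
      intro h
      have : ξ = 0 := by ext i; simp [h]
      simp [this] at hξ
    have h1 : 0 < ξ.ofLp ⬝ᵥ (((Matrix.of a)ᵀ * Matrix.of a)⁻¹ *ᵥ ξ.ofLp) := by
      simpa using hpd.dotProduct_mulVec_pos hξ0
    have h2 : q (a, ξ) = (Matrix.of a).det *
        (ξ.ofLp ⬝ᵥ (((Matrix.of a)ᵀ * Matrix.of a)⁻¹ *ᵥ ξ.ofLp)) := by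
      have : Matrix.of (coeffOfJacobian a) =
        (Matrix.of a).det • ((Matrix.of a)ᵀ * Matrix.of a)⁻¹ := rfl
      simp only [hq]
      rw [this, Matrix.smul_mulVec, smul_dotProduct, dotProduct_comm, smul_eq_mul]
    rw [h2]
    exact mul_pos (hδ.trans_le ha.2) h1
  obtain ⟨c, hc, hcq⟩ : ∃ c > 0, ∀ w ∈ boundedMatrices d R δ ×ˢ
      Metric.sphere (0 : EuclideanSpace ℝ (Fin d)) 1, c ≤ q w := by
    rcases (boundedMatrices d R δ ×ˢ
      Metric.sphere (0 : EuclideanSpace ℝ (Fin d)) 1).eq_empty_or_nonempty with h | h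
    · exact ⟨1, one_pos, by simp [h]⟩
    · obtain ⟨w, hw, hmin⟩ := hK.exists_isMinOn h hcont
      exact ⟨q w, hpos w hw, fun v hv => hmin hv⟩
  refine ⟨c, hc, fun a ha ξ => ?_⟩
  rcases eq_or_ne ξ 0 with rfl | hξ
  · simp
  have hn : ‖ξ‖ ≠ 0 := norm_ne_zero_iff.2 hξ
  have h := hcq (a, ‖ξ‖⁻¹ • ξ) ⟨ha, by simp [norm_smul, hn]⟩
  have h2 : q (a, ‖ξ‖⁻¹ • ξ) = ‖ξ‖⁻¹ ^ 2 * q (a, ξ) := by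
    simp only [hq, WithLp.ofLp_smul, Matrix.mulVec_smul, smul_dotProduct, dotProduct_smul,
      smul_eq_mul]
    ring
  rw [h2] at h
  calc c * ‖ξ‖ ^ 2 ≤ ‖ξ‖⁻¹ ^ 2 * q (a, ξ) * ‖ξ‖ ^ 2 := by gcongr
    _ = q (a, ξ) := by field_simp

/-- The absolute value of the determinant is the product of the singular values. -/
theorem pow_le_abs_det_of_le_singularValues {M : Matrix (Fin d) (Fin d) ℝ} {σ : ℝ} (hσ : 0 ≤ σ)
    (h : ∀ t ∈ singularValues M, σ ≤ t) : σ ^ d ≤ |M.det| := by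
  have h1 : (Matrix.toEuclideanLin M).det = M.det := by
    rw [Matrix.toEuclideanLin, Matrix.toLpLin_eq_toLin, LinearMap.det_toLin]
  rw [← h1, ← LinearMap.normDet_eq_abs_det, LinearMap.normDet_eq_prod_singularValues,
    finrank_euclideanSpace_fin, ← Fin.prod_univ_eq_prod_range]
  calc σ ^ d = ∏ _i : Fin d, σ := by simp
    _ ≤ _ := Finset.prod_le_prod (fun _ _ => hσ) fun i _ => h _ ⟨i, rfl⟩

end DomainUQ

namespace DomainUQ

/-! ### Perturbation of coercive variational problems -/

section Perturbation

variable {H : Type*} [NormedAddCommGroup H] [NormedSpace ℝ H]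

theorem norm_le_of_coercive {α M : ℝ} (hα : 0 < α) {B : H →L[ℝ] H →L[ℝ] ℝ}
    (hB : ∀ v, α * ‖v‖ ^ 2 ≤ B v v) {w : H} (hw : ‖B w‖ ≤ M) : ‖w‖ ≤ α⁻¹ * M := by
  rcases eq_or_ne w 0 with rfl | h0
  · simp only [norm_zero]
    exact mul_nonneg (inv_nonneg.2 hα.le) ((norm_nonneg _).trans hw)
  have hn : 0 < ‖w‖ := norm_pos_iff.2 h0
  have h1 : α * ‖w‖ ^ 2 ≤ M * ‖w‖ := (hB w).trans <| (Real.le_norm_self _).trans <|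
    ((B w).le_opNorm w).trans (by gcongr)
  rw [le_inv_mul_iff₀ hα]
  nlinarith

theorem norm_sub_le_of_coercive {α : ℝ} (hα : 0 < α) {B₁ B₂ : H →L[ℝ] H →L[ℝ] ℝ}
    (hB : ∀ v, α * ‖v‖ ^ 2 ≤ B₁ v v) {F₁ F₂ : H →L[ℝ] ℝ} {u₁ u₂ : H} (h₁ : B₁ u₁ = F₁)
    (h₂ : B₂ u₂ = F₂) : ‖u₁ - u₂‖ ≤ α⁻¹ * (‖F₁ - F₂‖ + ‖B₁ - B₂‖ * ‖u₂‖) := by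
  refine norm_le_of_coercive hα hB ?_
  have h : B₁ (u₁ - u₂) = (F₁ - F₂) - (B₁ - B₂) u₂ := by
    rw [map_sub, h₁, ← h₂, sub_apply]
    abel
  rw [h]
  exact (norm_sub_le _ _).trans (by gcongr; exact (B₁ - B₂).le_opNorm u₂)

/-- Second differences of solutions are controlled by second differences of the data and by
products of first differences. -/
theorem norm_second_difference_le_of_coercive {α : ℝ} (hα : 0 < α)
    {B₀ B₁ B₂ : H →L[ℝ] H →L[ℝ] ℝ} (hB : ∀ v, α * ‖v‖ ^ 2 ≤ B₀ v v) {F₀ F₁ F₂ : H →L[ℝ] ℝ}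
    {u₀ u₁ u₂ : H} (h₀ : B₀ u₀ = F₀) (h₁ : B₁ u₁ = F₁) (h₂ : B₂ u₂ = F₂) :
    ‖u₁ + u₂ - (2 : ℝ) • u₀‖ ≤ α⁻¹ * (‖F₁ + F₂ - (2 : ℝ) • F₀‖ +
      ‖B₁ + B₂ - (2 : ℝ) • B₀‖ * ‖u₀‖ + ‖B₁ - B₀‖ * ‖u₁ - u₀‖ + ‖B₂ - B₀‖ * ‖u₂ - u₀‖) := by
  refine norm_le_of_coercive hα hB ?_
  have h : B₀ (u₁ + u₂ - (2 : ℝ) • u₀) = (F₁ + F₂ - (2 : ℝ) • F₀) -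
      (B₁ + B₂ - (2 : ℝ) • B₀) u₀ - (B₁ - B₀) (u₁ - u₀) - (B₂ - B₀) (u₂ - u₀) := by
    simp only [map_sub, map_add, map_smul, sub_apply,
      add_apply, smul_apply, ← h₁, ← h₂, ← h₀]
    module
  rw [h]
  refine (norm_sub_le _ _).trans ?_
  gcongr
  · refine (norm_sub_le _ _).trans ?_
    gcongr
    · refine (norm_sub_le _ _).trans ?_
      gcongr
      exact ContinuousLinearMap.le_opNorm _ _
    · exact ContinuousLinearMap.le_opNorm _ _
  · exact ContinuousLinearMap.le_opNorm _ _

/-- If the data of a family of coercive problems have first differences bounded by `L t` and second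
differences bounded by `L t²`, then so do the solutions, with a constant that depends only on `L`,
on the coercivity constant and on a bound `m` for the sources. -/
theorem exists_bound_differences_of_coercive (α m L : ℝ) (hα : 0 < α) (hm : 0 ≤ m)
    (hL : 0 ≤ L) :
    ∃ C, 0 ≤ C ∧ (∀ (B₁ B₂ : H →L[ℝ] H →L[ℝ] ℝ) (F₁ F₂ : H →L[ℝ] ℝ) (u₁ u₂ : H) (t : ℝ), 0 ≤ t →
      (∀ v, α * ‖v‖ ^ 2 ≤ B₁ v v) → (∀ v, α * ‖v‖ ^ 2 ≤ B₂ v v) →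
      B₁ u₁ = F₁ → B₂ u₂ = F₂ → ‖F₁‖ ≤ m → ‖F₂‖ ≤ m → ‖F₁ - F₂‖ ≤ L * t →
      ‖B₁ - B₂‖ ≤ L * t → ‖u₁ - u₂‖ ≤ C * t) ∧
    (∀ (B₀ B₁ B₂ : H →L[ℝ] H →L[ℝ] ℝ) (F₀ F₁ F₂ : H →L[ℝ] ℝ) (u₀ u₁ u₂ : H) (t : ℝ), 0 ≤ t →
      (∀ v, α * ‖v‖ ^ 2 ≤ B₀ v v) → (∀ v, α * ‖v‖ ^ 2 ≤ B₁ v v) → (∀ v, α * ‖v‖ ^ 2 ≤ B₂ v v) →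
      B₀ u₀ = F₀ → B₁ u₁ = F₁ → B₂ u₂ = F₂ → ‖F₀‖ ≤ m → ‖F₁‖ ≤ m → ‖F₂‖ ≤ m →
      ‖F₁ - F₀‖ ≤ L * t → ‖B₁ - B₀‖ ≤ L * t → ‖F₂ - F₀‖ ≤ L * t → ‖B₂ - B₀‖ ≤ L * t →
      ‖F₁ + F₂ - (2 : ℝ) • F₀‖ ≤ L * t ^ 2 → ‖B₁ + B₂ - (2 : ℝ) • B₀‖ ≤ L * t ^ 2 →
      ‖u₁ + u₂ - (2 : ℝ) • u₀‖ ≤ C * t ^ 2) := by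
  have hα' : 0 ≤ α⁻¹ := inv_nonneg.2 hα.le
  set C₁ := α⁻¹ * (L + L * (α⁻¹ * m)) with hC₁
  have hC₁0 : 0 ≤ C₁ := by positivity
  have hfirst : ∀ (B₁ B₂ : H →L[ℝ] H →L[ℝ] ℝ) (F₁ F₂ : H →L[ℝ] ℝ) (u₁ u₂ : H) (t : ℝ), 0 ≤ t →
      (∀ v, α * ‖v‖ ^ 2 ≤ B₁ v v) → (∀ v, α * ‖v‖ ^ 2 ≤ B₂ v v) →
      B₁ u₁ = F₁ → B₂ u₂ = F₂ → ‖F₁‖ ≤ m → ‖F₂‖ ≤ m → ‖F₁ - F₂‖ ≤ L * t →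
      ‖B₁ - B₂‖ ≤ L * t → ‖u₁ - u₂‖ ≤ C₁ * t := by
    intro B₁ B₂ F₁ F₂ u₁ u₂ t ht hB₁ hB₂ h₁ h₂ hF₁ hF₂ hF hB
    have hu₂ : ‖u₂‖ ≤ α⁻¹ * m := norm_le_of_coercive hα hB₂ (h₂ ▸ hF₂)
    calc _ ≤ _ := norm_sub_le_of_coercive hα hB₁ h₁ h₂
      _ ≤ α⁻¹ * (L * t + L * t * (α⁻¹ * m)) := by
          gcongr
      _ = C₁ * t := by rw [hC₁]; ring
  refine ⟨max C₁ (α⁻¹ * (L + L * (α⁻¹ * m) + L * C₁ + L * C₁)), hC₁0.trans (le_max_left _ _),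
    ?_, ?_⟩
  · intro B₁ B₂ F₁ F₂ u₁ u₂ t ht hB₁ hB₂ h₁ h₂ hF₁ hF₂ hF hB
    exact (hfirst B₁ B₂ F₁ F₂ u₁ u₂ t ht hB₁ hB₂ h₁ h₂ hF₁ hF₂ hF hB).trans
      (by gcongr; exact le_max_left _ _)
  · intro B₀ B₁ B₂ F₀ F₁ F₂ u₀ u₁ u₂ t ht hB₀ hB₁ hB₂ h₀ h₁ h₂ hF₀ hF₁ hF₂ hF hB hF' hB' hFF hBB
    have hu₀ : ‖u₀‖ ≤ α⁻¹ * m := norm_le_of_coercive hα hB₀ (h₀ ▸ hF₀)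
    have e₁ := hfirst B₁ B₀ F₁ F₀ u₁ u₀ t ht hB₁ hB₀ h₁ h₀ hF₁ hF₀ hF hB
    have e₂ := hfirst B₂ B₀ F₂ F₀ u₂ u₀ t ht hB₂ hB₀ h₂ h₀ hF₂ hF₀ hF' hB'
    calc _ ≤ _ := norm_second_difference_le_of_coercive hα hB₀ h₀ h₁ h₂
      _ ≤ α⁻¹ * (L * t ^ 2 + L * t ^ 2 * (α⁻¹ * m) + L * t * (C₁ * t) + L * t * (C₁ * t)) := by
          gcongr
      _ = α⁻¹ * (L + L * (α⁻¹ * m) + L * C₁ + L * C₁) * t ^ 2 := by ring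
      _ ≤ _ := by gcongr; exact le_max_right _ _

end Perturbation

/-! ### Poincaré inequality and bounded forms on `H_0^1` -/

variable {d : ℕ} {Ω : Set (EuclideanSpace ℝ (Fin d))}

/-- The Poincaré inequality for test functions.  The Gagliardo-Nirenberg-Sobolev inequality bounds
`L²` norms by `L^{3/2}` norms of gradients, an admissible pair of exponents in dimensions two and
three, and `L²(Ω) ⊆ L^{3/2}(Ω)`. -/
theorem exists_poincare_of_isTestFunction (hd : d = 2 ∨ d = 3) (hb : Bornology.IsBounded Ω) :
    ∃ C : ℝ≥0∞, C ≠ ⊤ ∧ ∀ φ : EuclideanSpace ℝ (Fin d) → ℝ, IsTestFunction Ω φ →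
      eLpNorm φ 2 (volume.restrict Ω) ≤ C * eLpNorm (gradient φ) 2 (volume.restrict Ω) := by
  have hfin : volume Ω < ⊤ := hb.measure_lt_top
  have hq1 : (1 : ℝ≥0) ≤ 3 / 2 := by rw [← NNReal.coe_le_coe]; norm_num
  have hqd : (3 / 2 : ℝ≥0) < Module.finrank ℝ (EuclideanSpace ℝ (Fin d)) := by
    rw [finrank_euclideanSpace_fin, ← NNReal.coe_lt_coe]
    rcases hd with rfl | rfl <;> norm_num
  have hqq : (((3 / 2 : ℝ≥0)⁻¹ : ℝ≥0) : ℝ) -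
      (Module.finrank ℝ (EuclideanSpace ℝ (Fin d)) : ℝ)⁻¹ ≤ (((2 : ℝ≥0) : ℝ))⁻¹ := by
    rw [finrank_euclideanSpace_fin]
    rcases hd with rfl | rfl <;> norm_num
  have hq2 : ((3 / 2 : ℝ≥0) : ℝ≥0∞) ≤ 2 := by
    have : (3 / 2 : ℝ≥0) ≤ 2 := by rw [← NNReal.coe_le_coe]; norm_num
    exact_mod_cast this
  generalize (3 / 2 : ℝ≥0) = q at *
  have hexp : 0 ≤ 1 / (q : ℝ≥0∞).toReal - 1 / (2 : ℝ≥0∞).toReal := by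
    have h0 : (0 : ℝ) < q := by exact_mod_cast one_pos.trans_le hq1
    have h2 : (q : ℝ) ≤ 2 := by exact_mod_cast hq2
    rw [sub_nonneg, ENNReal.coe_toReal, ENNReal.toReal_ofNat]
    gcongr
  have hgns := fun (φ : EuclideanSpace ℝ (Fin d) → ℝ) (hφ : IsTestFunction Ω φ) =>
    eLpNorm_le_eLpNorm_fderiv_of_le volume
      (hφ.smooth.of_le (by exact_mod_cast le_top) : ContDiff ℝ 1 φ)
      ((subset_tsupport φ).trans hφ.support) hq1 hqd hqq hb
  obtain ⟨c, h1⟩ : ∃ c : ℝ≥0, ∀ φ : EuclideanSpace ℝ (Fin d) → ℝ, IsTestFunction Ω φ →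
      eLpNorm φ (2 : ℝ≥0) volume ≤ c * eLpNorm (fderiv ℝ φ) q volume := ⟨_, hgns⟩
  refine ⟨c * volume Ω ^ (1 / (q : ℝ≥0∞).toReal - 1 / (2 : ℝ≥0∞).toReal),
    ENNReal.mul_ne_top ENNReal.coe_ne_top (ENNReal.rpow_lt_top_of_nonneg hexp hfin.ne).ne,
    fun φ hφ => ?_⟩
  have h2 : eLpNorm (fderiv ℝ φ) q (volume.restrict Ω) = eLpNorm (fderiv ℝ φ) q volume := by
    have hs : Function.support (fun x => ‖fderiv ℝ φ x‖) ⊆ Ω := by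
      refine Set.Subset.trans (fun x hx => ?_) ((support_fderiv_subset ℝ).trans hφ.support)
      exact fun h => hx (by simp [h])
    rw [← eLpNorm_norm, ← eLpNorm_norm (fderiv ℝ φ),
      eLpNorm_restrict_eq_of_support_subset hs]
  have hmeas : AEStronglyMeasurable (fderiv ℝ φ) (volume.restrict Ω) :=
    (hφ.smooth.continuous_fderiv (by simp)).aestronglyMeasurable
  have h3 := eLpNorm_le_eLpNorm_mul_rpow_measure_univ hq2 hmeas
  rw [Measure.restrict_apply_univ] at h3
  have h4 : eLpNorm (fderiv ℝ φ) 2 (volume.restrict Ω) =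
      eLpNorm (gradient φ) 2 (volume.restrict Ω) := by
    refine eLpNorm_congr_norm_ae (Filter.Eventually.of_forall fun x => ?_)
    simp [gradient]
  calc eLpNorm φ 2 (volume.restrict Ω) ≤ eLpNorm φ (2 : ℝ≥0) volume :=
        eLpNorm_mono_measure φ Measure.restrict_le_self
    _ ≤ c * eLpNorm (fderiv ℝ φ) q (volume.restrict Ω) := (h1 φ hφ).trans_eq (by rw [h2])
    _ ≤ c * (eLpNorm (gradient φ) 2 (volume.restrict Ω) *
        volume Ω ^ (1 / (q : ℝ≥0∞).toReal - 1 / (2 : ℝ≥0∞).toReal)) := by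
      rw [← h4]
      gcongr
    _ = _ := by ring

/-- The Poincaré inequality on `H_0^1(Ω)` for bounded `Ω`. -/
theorem exists_poincare (hd : d = 2 ∨ d = 3) (hb : Bornology.IsBounded Ω) :
    ∃ C, 0 ≤ C ∧ ∀ u : H01 Ω, ‖H01.fn u‖ ≤ C * ‖H01.grad u‖ := by
  obtain ⟨C, hC, hφ⟩ := exists_poincare_of_isTestFunction hd hb
  refine ⟨C.toReal, ENNReal.toReal_nonneg, fun u => ?_⟩
  have hclosed : IsClosed {w : L2Pair Ω | ‖w.fst‖ ≤ C.toReal * ‖w.snd‖} := by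
    have h1 : Continuous fun w : L2Pair Ω => w.fst := by fun_prop
    have h2 : Continuous fun w : L2Pair Ω => w.snd := by fun_prop
    exact isClosed_le h1.norm (continuous_const.mul h2.norm)
  have hsub : (testPairs Ω : Set (L2Pair Ω)) ⊆
      {w : L2Pair Ω | ‖w.fst‖ ≤ C.toReal * ‖w.snd‖} := by
    rintro w ⟨φ, hφt, h1, h2⟩
    simp only [Set.mem_ofPred_eq, Lp.norm_def, ← ENNReal.toReal_mul]
    refine ENNReal.toReal_mono (ENNReal.mul_ne_top hC (Lp.eLpNorm_ne_top _)) ?_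
    rw [eLpNorm_congr_ae h1, eLpNorm_congr_ae h2]
    exact hφ φ hφt
  exact closure_minimal hsub hclosed u.2

theorem integrable_norm_mul_norm {X E F : Type*} [MeasurableSpace X] {μ : Measure X}
    [NormedAddCommGroup E] [NormedAddCommGroup F] (f : Lp E 2 μ) (g : Lp F 2 μ) :
    Integrable (fun x => ‖f x‖ * ‖g x‖) μ ∧ ∫ x, ‖f x‖ * ‖g x‖ ∂μ ≤ ‖f‖ * ‖g‖ := by
  have hf := Lp.memLp f
  have hg := Lp.memLp g
  refine ⟨hf.norm.integrable_mul hg.norm, ?_⟩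
  have h := integral_mul_norm_le_Lp_mul_Lq (μ := μ) (f := fun x => ‖f x‖) (g := fun x => ‖g x‖)
    Real.HolderConjugate.two_two (by simpa using hf.norm) (by simpa using hg.norm)
  simp only [norm_norm] at h
  refine h.trans (le_of_eq ?_)
  rw [Lp.norm_def, Lp.norm_def, hf.eLpNorm_eq_integral_rpow_norm two_ne_zero ENNReal.ofNat_ne_top,
    hg.eLpNorm_eq_integral_rpow_norm two_ne_zero ENNReal.ofNat_ne_top,
    ENNReal.toReal_ofReal (by positivity), ENNReal.toReal_ofReal (by positivity)]
  simp

theorem norm_sq_eq_fn_add_grad (u : H01 Ω) : ‖u‖ ^ 2 = ‖H01.fn u‖ ^ 2 + ‖H01.grad u‖ ^ 2 :=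
  WithLp.prod_norm_sq_eq_of_L2 (u : L2Pair Ω)

theorem norm_grad_le (u : H01 Ω) : ‖H01.grad u‖ ≤ ‖u‖ := by
  have := norm_sq_eq_fn_add_grad u
  exact le_of_sq_le_sq (by nlinarith [sq_nonneg ‖H01.fn u‖]) (norm_nonneg _)

theorem norm_fn_le (u : H01 Ω) : ‖H01.fn u‖ ≤ ‖u‖ := by
  have := norm_sq_eq_fn_add_grad u
  exact le_of_sq_le_sq (by nlinarith [sq_nonneg ‖H01.grad u‖]) (norm_nonneg _)

theorem exists_l1Norm_le (hb : Bornology.IsBounded Ω) :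
    ∃ C, 0 ≤ C ∧ ∀ u : H01 Ω, Integrable (H01.fn u) (volume.restrict Ω) ∧
      H01.l1Norm u ≤ C * ‖u‖ := by
  have : IsFiniteMeasure (volume.restrict Ω) := ⟨by simpa using hb.measure_lt_top⟩
  set e : Lp ℝ 2 (volume.restrict Ω) := Lp.const 2 _ 1
  refine ⟨‖e‖, norm_nonneg _, fun u => ⟨(Lp.memLp (H01.fn u)).integrable (by norm_num), ?_⟩⟩
  have h := (integrable_norm_mul_norm e (H01.fn u)).2
  have h1 : H01.l1Norm u = ∫ x in Ω, ‖e x‖ * ‖H01.fn u x‖ := by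
    refine integral_congr_ae ?_
    filter_upwards [Lp.coeFn_const (p := 2) (volume.restrict Ω) (1 : ℝ)] with x hx
    change |H01.fn u x| = ‖Lp.const 2 (volume.restrict Ω) (1 : ℝ) x‖ * ‖H01.fn u x‖
    rw [hx]
    simp
  rw [h1]
  exact h.trans (by gcongr; exact norm_fn_le u)

end DomainUQ

namespace DomainUQ

variable {d : ℕ} {Ω : Set (EuclideanSpace ℝ (Fin d))}
  {H : Type*} [NormedAddCommGroup H] [NormedSpace ℝ H]
  {G : H →ₗ[ℝ] Lp (EuclideanSpace ℝ (Fin d)) 2 (volume.restrict Ω)}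
  {N : H →ₗ[ℝ] Lp ℝ 2 (volume.restrict Ω)}

/-! ### Energy forms and sources -/

theorem abs_mulVec_dotProduct_le (a : Fin d → Fin d → ℝ) (ξ η : EuclideanSpace ℝ (Fin d)) :
    |(Matrix.of a *ᵥ ξ.ofLp) ⬝ᵥ η.ofLp| ≤ (d : ℝ) ^ 2 * ‖a‖ * (‖ξ‖ * ‖η‖) := by
  simp only [Matrix.mulVec, dotProduct, Matrix.of_apply]
  have hterm : ∀ i j, |a i j * ξ.ofLp j * η.ofLp i| ≤ ‖a‖ * (‖ξ‖ * ‖η‖) := by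
    intro i j
    have h1 : |a i j| ≤ ‖a‖ := (norm_le_pi_norm (a i) j).trans (norm_le_pi_norm a i)
    have h2 : |ξ.ofLp j| ≤ ‖ξ‖ := PiLp.norm_apply_le ξ j
    have h3 : |η.ofLp i| ≤ ‖η‖ := PiLp.norm_apply_le η i
    rw [abs_mul, abs_mul, mul_assoc]
    gcongr
  calc |∑ i, (∑ j, a i j * ξ.ofLp j) * η.ofLp i|
      ≤ ∑ i, ∑ j, |a i j * ξ.ofLp j * η.ofLp i| := by
        refine (Finset.abs_sum_le_sum_abs _ _).trans (Finset.sum_le_sum fun i _ => ?_)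
        rw [Finset.sum_mul]
        exact Finset.abs_sum_le_sum_abs _ _
    _ ≤ ∑ _i : Fin d, ∑ _j : Fin d, ‖a‖ * (‖ξ‖ * ‖η‖) :=
        Finset.sum_le_sum fun i _ => Finset.sum_le_sum fun j _ => hterm i j
    _ = _ := by simp; ring

/-- `g` is measurable on `Ω` and bounded there by `M ≥ 0`. -/
structure BoundedOn {F : Type*} [NormedAddCommGroup F] (Ω : Set (EuclideanSpace ℝ (Fin d)))
    (g : EuclideanSpace ℝ (Fin d) → F) (M : ℝ) : Prop where
  meas : AEStronglyMeasurable g (volume.restrict Ω)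
  bound : ∀ x ∈ Ω, ‖g x‖ ≤ M
  nonneg : 0 ≤ M

/-- The integrand `(a ξ) · η` of the energy form with coefficient field `a`, as a function of the two
gradients `ξ` and `η`. -/
noncomputable def energyDensity (a : EuclideanSpace ℝ (Fin d) → Fin d → Fin d → ℝ)
    (ξ η : Lp (EuclideanSpace ℝ (Fin d)) 2 (volume.restrict Ω))
    (x : EuclideanSpace ℝ (Fin d)) : ℝ :=
  (Matrix.of (a x) *ᵥ (ξ x).ofLp) ⬝ᵥ (η x).ofLp

theorem BoundedOn.energyDensity (hΩ : IsOpen Ω)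
    {a : EuclideanSpace ℝ (Fin d) → Fin d → Fin d → ℝ} {M : ℝ} (ha : BoundedOn Ω a M)
    (ξ η : Lp (EuclideanSpace ℝ (Fin d)) 2 (volume.restrict Ω)) :
    Integrable (energyDensity a ξ η) (volume.restrict Ω) ∧
      |∫ x in Ω, DomainUQ.energyDensity a ξ η x| ≤ (d : ℝ) ^ 2 * M * (‖ξ‖ * ‖η‖) := by
  obtain ⟨hint, hle⟩ := integrable_norm_mul_norm (ξ) (η)
  have hmeas : AEStronglyMeasurable (DomainUQ.energyDensity a ξ η) (volume.restrict Ω) := by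
    have h1 : ∀ i j, AEStronglyMeasurable (fun x => a x i j) (volume.restrict Ω) := fun i j =>
      (by fun_prop : Continuous fun m : Fin d → Fin d → ℝ => m i j).comp_aestronglyMeasurable
        ha.meas
    have h2 : ∀ (w : Lp (EuclideanSpace ℝ (Fin d)) 2 (volume.restrict Ω)) i,
        AEStronglyMeasurable (fun x => (w x).ofLp i)
        (volume.restrict Ω) := fun w i =>
      (by fun_prop : Continuous fun m : EuclideanSpace ℝ (Fin d) =>
        m.ofLp i).comp_aestronglyMeasurable (Lp.aestronglyMeasurable (w))
    unfold DomainUQ.energyDensity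
    simp only [Matrix.mulVec, dotProduct, Matrix.of_apply]
    exact Finset.aestronglyMeasurable_fun_sum _ fun i _ =>
      (Finset.aestronglyMeasurable_fun_sum _ fun j _ => (h1 i j).mul (h2 ξ j)).mul (h2 η i)
  have hb : ∀ᵐ x ∂volume.restrict Ω, ‖DomainUQ.energyDensity a ξ η x‖ ≤
      (d : ℝ) ^ 2 * M * (‖ξ x‖ * ‖η x‖) := by
    filter_upwards [ae_restrict_mem hΩ.measurableSet] with x hx
    refine (abs_mulVec_dotProduct_le _ _ _).trans ?_
    gcongr
    exact ha.bound x hx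
  refine ⟨(hint.const_mul _).mono' hmeas hb, ?_⟩
  have hM := ha.nonneg
  calc |∫ x in Ω, DomainUQ.energyDensity a ξ η x|
      ≤ ∫ x in Ω, (d : ℝ) ^ 2 * M * (‖ξ x‖ * ‖η x‖) :=
        norm_integral_le_of_norm_le (hint.const_mul _) hb
    _ = (d : ℝ) ^ 2 * M * ∫ x in Ω, ‖ξ x‖ * ‖η x‖ := integral_const_mul _ _
    _ ≤ (d : ℝ) ^ 2 * M * (‖ξ‖ * ‖η‖) := by
        gcongr

/-- `B` is the energy form `(u, v) ↦ ∫ (a ∇u) · ∇v`, all integrands being integrable. -/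
def IsEnergyForm (G : H →ₗ[ℝ] Lp (EuclideanSpace ℝ (Fin d)) 2 (volume.restrict Ω))
    (a : EuclideanSpace ℝ (Fin d) → Fin d → Fin d → ℝ)
    (B : H →L[ℝ] H →L[ℝ] ℝ) : Prop :=
  ∀ u v, Integrable (energyDensity a (G u) (G v)) (volume.restrict Ω) ∧
    B u v = ∫ x in Ω, energyDensity a (G u) (G v) x

/-- `F` is the functional `v ↦ ∫ g v`, all integrands being integrable. -/
def IsSource (N : H →ₗ[ℝ] Lp ℝ 2 (volume.restrict Ω)) (g : EuclideanSpace ℝ (Fin d) → ℝ)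
    (F : H →L[ℝ] ℝ) : Prop :=
  ∀ v, Integrable (fun x => g x * N v x) (volume.restrict Ω) ∧
    F v = ∫ x in Ω, g x * N v x

theorem exists_isEnergyForm (hΩ : IsOpen Ω) (hG : ∀ u, ‖G u‖ ≤ ‖u‖)
    {a : EuclideanSpace ℝ (Fin d) → Fin d → Fin d → ℝ}
    {M : ℝ} (ha : BoundedOn Ω a M) : ∃ B : H →L[ℝ] H →L[ℝ] ℝ, IsEnergyForm G a B := by
  have hi := fun u v => (ha.energyDensity hΩ (G u) (G v)).1
  let L : H →ₗ[ℝ] H →ₗ[ℝ] ℝ := LinearMap.mk₂ ℝ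
    (fun u v => ∫ x in Ω, energyDensity a (G u) (G v) x)
    (fun u u' v => by
      rw [← integral_add (hi u v) (hi u' v)]
      refine integral_congr_ae ?_
      filter_upwards [Lp.coeFn_add (G u) (G u')] with x hx
      simp only [energyDensity, map_add, hx, Pi.add_apply, WithLp.ofLp_add, Matrix.mulVec_add,
        add_dotProduct])
    (fun c u v => by
      rw [smul_eq_mul, ← integral_const_mul]
      refine integral_congr_ae ?_
      filter_upwards [Lp.coeFn_smul c (G u)] with x hx
      simp only [energyDensity, map_smul, hx, Pi.smul_apply, WithLp.ofLp_smul, Matrix.mulVec_smul,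
        smul_dotProduct, smul_eq_mul])
    (fun u v v' => by
      rw [← integral_add (hi u v) (hi u v')]
      refine integral_congr_ae ?_
      filter_upwards [Lp.coeFn_add (G v) (G v')] with x hx
      simp only [energyDensity, map_add, hx, Pi.add_apply, WithLp.ofLp_add, dotProduct_add])
    (fun c u v => by
      rw [smul_eq_mul, ← integral_const_mul]
      refine integral_congr_ae ?_
      filter_upwards [Lp.coeFn_smul c (G v)] with x hx
      simp only [energyDensity, map_smul, hx, Pi.smul_apply, WithLp.ofLp_smul, dotProduct_smul,
        smul_eq_mul])
  refine ⟨L.mkContinuous₂ ((d : ℝ) ^ 2 * M) fun u v => ?_, fun u v => ⟨hi u v, rfl⟩⟩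
  rw [mul_assoc]
  refine (ha.energyDensity hΩ (G u) (G v)).2.trans ?_
  have hM := ha.nonneg
  gcongr
  exacts [hG u, hG v]

theorem IsEnergyForm.norm_le (hΩ : IsOpen Ω) (hG : ∀ u, ‖G u‖ ≤ ‖u‖)
    {a : EuclideanSpace ℝ (Fin d) → Fin d → Fin d → ℝ} {M : ℝ}
    (ha : BoundedOn Ω a M) {B : H →L[ℝ] H →L[ℝ] ℝ} (hB : IsEnergyForm G a B) :
    ‖B‖ ≤ (d : ℝ) ^ 2 * M :=
  B.opNorm_le_bound₂ (mul_nonneg (by positivity) ha.nonneg) fun u v => by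
    rw [(hB u v).2, mul_assoc]
    refine (ha.energyDensity hΩ (G u) (G v)).2.trans ?_
    have hM := ha.nonneg
    gcongr
    exacts [hG u, hG v]

theorem IsEnergyForm.add {a b : EuclideanSpace ℝ (Fin d) → Fin d → Fin d → ℝ}
    {A B : H →L[ℝ] H →L[ℝ] ℝ} (hA : IsEnergyForm G a A) (hB : IsEnergyForm G b B) :
    IsEnergyForm G (fun x => a x + b x) (A + B) := by
  intro u v
  have h : energyDensity (fun x => a x + b x) (G u) (G v) =
      fun x => energyDensity a (G u) (G v) x + energyDensity b (G u) (G v) x := by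
    funext x
    simp only [energyDensity, ← Matrix.of_add_of, Matrix.add_mulVec, add_dotProduct]
  rw [h]
  refine ⟨(hA u v).1.add (hB u v).1, ?_⟩
  rw [integral_add (hA u v).1 (hB u v).1, ← (hA u v).2, ← (hB u v).2,
    add_apply, add_apply]

theorem IsEnergyForm.smul {a : EuclideanSpace ℝ (Fin d) → Fin d → Fin d → ℝ} (c : ℝ)
    {A : H →L[ℝ] H →L[ℝ] ℝ} (hA : IsEnergyForm G a A) :
    IsEnergyForm G (fun x => c • a x) (c • A) := by
  intro u v
  have h : energyDensity (fun x => c • a x) (G u) (G v) =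
      fun x => c * energyDensity a (G u) (G v) x := by
    funext x
    simp only [energyDensity, ← Matrix.smul_of, Matrix.smul_mulVec, smul_dotProduct, smul_eq_mul]
  rw [h]
  refine ⟨(hA u v).1.const_mul c, ?_⟩
  rw [integral_const_mul, ← (hA u v).2, smul_apply, smul_apply, smul_eq_mul]

theorem IsEnergyForm.sub {a b : EuclideanSpace ℝ (Fin d) → Fin d → Fin d → ℝ}
    {A B : H →L[ℝ] H →L[ℝ] ℝ} (hA : IsEnergyForm G a A) (hB : IsEnergyForm G b B) :
    IsEnergyForm G (fun x => a x - b x) (A - B) := by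
  intro u v
  have h : energyDensity (fun x => a x - b x) (G u) (G v) =
      fun x => energyDensity a (G u) (G v) x - energyDensity b (G u) (G v) x := by
    funext x
    simp only [energyDensity, ← Matrix.of_sub_of, Matrix.sub_mulVec, sub_dotProduct]
  rw [h]
  refine ⟨(hA u v).1.sub (hB u v).1, ?_⟩
  rw [integral_sub (hA u v).1 (hB u v).1, ← (hA u v).2, ← (hB u v).2, sub_apply, sub_apply]

theorem IsEnergyForm.coercive (hΩ : IsOpen Ω)
    {a : EuclideanSpace ℝ (Fin d) → Fin d → Fin d → ℝ} {c P : ℝ} (hc : 0 < c) (hP : 0 < P)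
    (hpoin : ∀ u : H, ‖u‖ ^ 2 ≤ P * ‖G u‖ ^ 2)
    (ha : ∀ x ∈ Ω, ∀ ξ : EuclideanSpace ℝ (Fin d),
      c * ‖ξ‖ ^ 2 ≤ (Matrix.of (a x) *ᵥ ξ.ofLp) ⬝ᵥ ξ.ofLp)
    {B : H →L[ℝ] H →L[ℝ] ℝ} (hB : IsEnergyForm G a B) (u : H) :
    c / P * ‖u‖ ^ 2 ≤ B u u := by
  have h1 : c * ‖G u‖ ^ 2 ≤ B u u := by
    have hsq : ‖G u‖ ^ 2 = ∫ x in Ω, ‖G u x‖ ^ 2 := by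
      rw [← real_inner_self_eq_norm_sq, L2.inner_def]
      exact integral_congr_ae (ae_of_all _ fun x => real_inner_self_eq_norm_sq _)
    rw [(hB u u).2, hsq, ← integral_const_mul]
    refine integral_mono_ae ?_ (hB u u).1 ?_
    · have := (integrable_norm_mul_norm (G u) (G u)).1
      simp only [← sq] at this
      exact this.const_mul c
    · filter_upwards [ae_restrict_mem hΩ.measurableSet] with x hx
      exact ha x hx _
  calc c / P * ‖u‖ ^ 2 ≤ c / P * (P * ‖G u‖ ^ 2) := by
        gcongr
        exact hpoin u
    _ = c * ‖G u‖ ^ 2 := by field_simp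
    _ ≤ _ := h1

theorem BoundedOn.source (hΩ : IsOpen Ω) {g : EuclideanSpace ℝ (Fin d) → ℝ} {M C : ℝ}
    (hg : BoundedOn Ω g M)
    (hC : ∀ u, Integrable (N u) (volume.restrict Ω) ∧
      ∫ x in Ω, |N u x| ≤ C * ‖u‖)
    (v : H) : Integrable (fun x => g x * N v x) (volume.restrict Ω) ∧
      |∫ x in Ω, g x * N v x| ≤ C * M * ‖v‖ := by
  have hM := hg.nonneg
  have hb : ∀ᵐ x ∂volume.restrict Ω, ‖g x * N v x‖ ≤ M * |N v x| := by
    filter_upwards [ae_restrict_mem hΩ.measurableSet] with x hx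
    rw [norm_mul]
    exact mul_le_mul_of_nonneg_right (hg.bound x hx) (norm_nonneg _)
  have hi : Integrable (fun x => M * |N v x|) (volume.restrict Ω) :=
    (hC v).1.abs.const_mul M
  refine ⟨hi.mono' (hg.meas.mul (Lp.aestronglyMeasurable _)) hb, ?_⟩
  calc |∫ x in Ω, g x * N v x| ≤ ∫ x in Ω, M * |N v x| :=
        norm_integral_le_of_norm_le hi hb
    _ = M * ∫ x in Ω, |N v x| := integral_const_mul _ _
    _ ≤ M * (C * ‖v‖) := by gcongr; exact (hC v).2
    _ = _ := by ring

theorem exists_isSource (hΩ : IsOpen Ω) {g : EuclideanSpace ℝ (Fin d) → ℝ} {M C : ℝ}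
    (hg : BoundedOn Ω g M)
    (hC : ∀ u, Integrable (N u) (volume.restrict Ω) ∧
      ∫ x in Ω, |N u x| ≤ C * ‖u‖) :
    ∃ F : H →L[ℝ] ℝ, IsSource N g F := by
  have hi := fun v => (hg.source hΩ hC v).1
  let L : H →ₗ[ℝ] ℝ :=
    { toFun := fun v => ∫ x in Ω, g x * N v x
      map_add' := fun v w => by
        rw [← integral_add (hi v) (hi w)]
        refine integral_congr_ae ?_
        filter_upwards [Lp.coeFn_add (N v) (N w)] with x hx
        rw [map_add, hx, Pi.add_apply, mul_add]
      map_smul' := fun c v => by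
        rw [RingHom.id_apply, smul_eq_mul, ← integral_const_mul]
        refine integral_congr_ae ?_
        filter_upwards [Lp.coeFn_smul c (N v)] with x hx
        rw [map_smul, hx, Pi.smul_apply, smul_eq_mul]
        ring }
  exact ⟨L.mkContinuous (C * M) fun v => (hg.source hΩ hC v).2, fun v => ⟨hi v, rfl⟩⟩

theorem IsSource.norm_le (hΩ : IsOpen Ω) {g : EuclideanSpace ℝ (Fin d) → ℝ} {M C : ℝ}
    (hC0 : 0 ≤ C) (hg : BoundedOn Ω g M)
    (hC : ∀ u, Integrable (N u) (volume.restrict Ω) ∧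
      ∫ x in Ω, |N u x| ≤ C * ‖u‖)
    {F : H →L[ℝ] ℝ} (hF : IsSource N g F) : ‖F‖ ≤ C * M :=
  F.opNorm_le_bound (mul_nonneg hC0 hg.nonneg) fun v => by
    rw [(hF v).2]
    exact (hg.source hΩ hC v).2

theorem IsSource.add {g h : EuclideanSpace ℝ (Fin d) → ℝ} {F G : H →L[ℝ] ℝ}
    (hF : IsSource N g F) (hG : IsSource N h G) : IsSource N (fun x => g x + h x) (F + G) := by
  intro v
  simp only [add_mul]
  refine ⟨(hF v).1.add (hG v).1, ?_⟩
  rw [integral_add (hF v).1 (hG v).1, ← (hF v).2, ← (hG v).2]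
  rfl

theorem IsSource.smul (c : ℝ) {g : EuclideanSpace ℝ (Fin d) → ℝ} {F : H →L[ℝ] ℝ}
    (hF : IsSource N g F) : IsSource N (fun x => c • g x) (c • F) := by
  intro v
  simp only [smul_eq_mul, mul_assoc]
  refine ⟨(hF v).1.const_mul c, ?_⟩
  rw [integral_const_mul, ← (hF v).2]
  rfl

theorem IsSource.sub {g h : EuclideanSpace ℝ (Fin d) → ℝ} {F G : H →L[ℝ] ℝ}
    (hF : IsSource N g F) (hG : IsSource N h G) : IsSource N (fun x => g x - h x) (F - G) := by
  have h := hF.add (hG.smul (-1))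
  have e : F + (-1 : ℝ) • G = F - G := by module
  simpa only [e, neg_smul, one_smul, ← sub_eq_add_neg] using h

/-! ### Elliptic problems with bounded coefficients -/

/-- `u` is a weak solution of the elliptic problem with coefficient field `a` and source `g`, both
bounded by `M`, and with ellipticity constant `c`. -/
structure IsEllipticSolution (G : H →ₗ[ℝ] Lp (EuclideanSpace ℝ (Fin d)) 2 (volume.restrict Ω))
    (N : H →ₗ[ℝ] Lp ℝ 2 (volume.restrict Ω)) (c M : ℝ)
    (a : EuclideanSpace ℝ (Fin d) → Fin d → Fin d → ℝ) (g : EuclideanSpace ℝ (Fin d) → ℝ)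
    (u : H) : Prop where
  coeff_bounded : BoundedOn Ω a M
  elliptic : ∀ x ∈ Ω, ∀ ξ : EuclideanSpace ℝ (Fin d),
    c * ‖ξ‖ ^ 2 ≤ (Matrix.of (a x) *ᵥ ξ.ofLp) ⬝ᵥ ξ.ofLp
  source_bounded : BoundedOn Ω g M
  weak : ∀ v, ∫ x in Ω, energyDensity a (G u) (G v) x = ∫ x in Ω, g x * N v x

theorem existsUnique_weakSolution {H : Type*} [NormedAddCommGroup H] [InnerProductSpace ℝ H]
    [CompleteSpace H] {G : H →ₗ[ℝ] Lp (EuclideanSpace ℝ (Fin d)) 2 (volume.restrict Ω)}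
    {N : H →ₗ[ℝ] Lp ℝ 2 (volume.restrict Ω)} (hΩ : IsOpen Ω) {c M P C : ℝ} (hc : 0 < c)
    (hP : 0 < P) (hG : ∀ u, ‖G u‖ ≤ ‖u‖) (hpoin : ∀ u : H, ‖u‖ ^ 2 ≤ P * ‖G u‖ ^ 2)
    (hC : ∀ u, Integrable (N u) (volume.restrict Ω) ∧ ∫ x in Ω, |N u x| ≤ C * ‖u‖)
    {a : EuclideanSpace ℝ (Fin d) → Fin d → Fin d → ℝ} {g : EuclideanSpace ℝ (Fin d) → ℝ}
    (ha : BoundedOn Ω a M) (hell : ∀ x ∈ Ω, ∀ ξ : EuclideanSpace ℝ (Fin d),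
      c * ‖ξ‖ ^ 2 ≤ (Matrix.of (a x) *ᵥ ξ.ofLp) ⬝ᵥ ξ.ofLp) (hg : BoundedOn Ω g M) :
    ∃! u : H, ∀ v, ∫ x in Ω, energyDensity a (G u) (G v) x = ∫ x in Ω, g x * N v x := by
  obtain ⟨B, hB⟩ := exists_isEnergyForm hΩ hG ha
  obtain ⟨F, hF⟩ := exists_isSource hΩ hg hC
  have hcoer : IsCoercive B := ⟨c / P, by positivity, fun u => by
    have := hB.coercive hΩ hc hP hpoin hell u
    rwa [sq, ← mul_assoc] at this⟩
  have hiff : ∀ u : H, (∀ v, ∫ x in Ω, energyDensity a (G u) (G v) x = ∫ x in Ω, g x * N v x) ↔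
      hcoer.continuousLinearEquivOfBilin u = (InnerProductSpace.toDual ℝ H).symm F := by
    intro u
    constructor
    · intro h
      refine ext_inner_right ℝ fun v => ?_
      rw [hcoer.continuousLinearEquivOfBilin_apply, InnerProductSpace.toDual_symm_apply,
        (hB u v).2, (hF v).2, h v]
    · intro h v
      rw [← (hB u v).2, ← (hF v).2, ← hcoer.continuousLinearEquivOfBilin_apply, h,
        InnerProductSpace.toDual_symm_apply]
  simp only [hiff]
  exact hcoer.continuousLinearEquivOfBilin.bijective.existsUnique _

/-- First and second differences of the data, measured in the sup norm, control first and second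
differences of the weak solutions. -/
theorem exists_bound_differences_of_isEllipticSolution (hΩ : IsOpen Ω) {c M L P C : ℝ}
    (hc : 0 < c) (hM : 0 ≤ M) (hL : 0 ≤ L) (hP : 0 < P) (hC0 : 0 ≤ C)
    (hG : ∀ u, ‖G u‖ ≤ ‖u‖) (hpoin : ∀ u : H, ‖u‖ ^ 2 ≤ P * ‖G u‖ ^ 2)
    (hC : ∀ u, Integrable (N u) (volume.restrict Ω) ∧ ∫ x in Ω, |N u x| ≤ C * ‖u‖) :
    ∃ K, 0 ≤ K ∧ (∀ a₁ a₂ g₁ g₂ u₁ u₂ t, 0 ≤ t → IsEllipticSolution G N c M a₁ g₁ u₁ →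
      IsEllipticSolution G N c M a₂ g₂ u₂ → (∀ x ∈ Ω, ‖a₁ x - a₂ x‖ ≤ L * t) →
      (∀ x ∈ Ω, ‖g₁ x - g₂ x‖ ≤ L * t) → ‖u₁ - u₂‖ ≤ K * t) ∧
    (∀ a₀ a₁ a₂ g₀ g₁ g₂ u₀ u₁ u₂ t, 0 ≤ t → IsEllipticSolution G N c M a₀ g₀ u₀ →
      IsEllipticSolution G N c M a₁ g₁ u₁ → IsEllipticSolution G N c M a₂ g₂ u₂ →
      (∀ x ∈ Ω, ‖a₁ x - a₀ x‖ ≤ L * t) → (∀ x ∈ Ω, ‖a₂ x - a₀ x‖ ≤ L * t) →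
      (∀ x ∈ Ω, ‖g₁ x - g₀ x‖ ≤ L * t) → (∀ x ∈ Ω, ‖g₂ x - g₀ x‖ ≤ L * t) →
      (∀ x ∈ Ω, ‖a₁ x + a₂ x - (2 : ℝ) • a₀ x‖ ≤ L * t ^ 2) →
      (∀ x ∈ Ω, ‖g₁ x + g₂ x - (2 : ℝ) • g₀ x‖ ≤ L * t ^ 2) →
      ‖u₁ + u₂ - (2 : ℝ) • u₀‖ ≤ K * t ^ 2) := by
  set L' := max ((d : ℝ) ^ 2 * L) (C * L)
  obtain ⟨K, hK, hK₁, hK₂⟩ := exists_bound_differences_of_coercive (H := H) (c / P) (C * M) L'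
    (by positivity) (by positivity) ((by positivity : 0 ≤ C * L).trans (le_max_right _ _))
  have hdata : ∀ {a g u}, IsEllipticSolution G N c M a g u →
      ∃ (B : H →L[ℝ] H →L[ℝ] ℝ) (F : H →L[ℝ] ℝ), IsEnergyForm G a B ∧ IsSource N g F ∧
        (∀ v, c / P * ‖v‖ ^ 2 ≤ B v v) ∧ B u = F ∧ ‖F‖ ≤ C * M := by
    intro a g u h
    obtain ⟨B, hB⟩ := exists_isEnergyForm hΩ hG h.coeff_bounded
    obtain ⟨F, hF⟩ := exists_isSource hΩ h.source_bounded hC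
    refine ⟨B, F, hB, hF, hB.coercive hΩ hc hP hpoin h.elliptic, ?_,
      hF.norm_le hΩ hC0 h.source_bounded hC⟩
    ext v
    rw [(hB u v).2, (hF v).2, h.weak v]
  have hBle : ∀ {a : EuclideanSpace ℝ (Fin d) → Fin d → Fin d → ℝ} {B : H →L[ℝ] H →L[ℝ] ℝ}
      {s : ℝ}, IsEnergyForm G a B → AEStronglyMeasurable a (volume.restrict Ω) →
      0 ≤ s → (∀ x ∈ Ω, ‖a x‖ ≤ L * s) → ‖B‖ ≤ L' * s := by
    intro a B s hB hm hs hb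
    refine (hB.norm_le hΩ hG ⟨hm, hb, by positivity⟩).trans ?_
    rw [← mul_assoc]
    gcongr
    exact le_max_left _ _
  have hFle : ∀ {g : EuclideanSpace ℝ (Fin d) → ℝ} {F : H →L[ℝ] ℝ}
      {s : ℝ}, IsSource N g F → AEStronglyMeasurable g (volume.restrict Ω) →
      0 ≤ s → (∀ x ∈ Ω, ‖g x‖ ≤ L * s) → ‖F‖ ≤ L' * s := by
    intro g F s hF hm hs hb
    refine (hF.norm_le hΩ hC0 ⟨hm, hb, by positivity⟩ hC).trans ?_
    rw [← mul_assoc]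
    gcongr
    exact le_max_right _ _
  refine ⟨K, hK, ?_, ?_⟩
  · intro a₁ a₂ g₁ g₂ u₁ u₂ t ht h₁ h₂ ha hg
    obtain ⟨B₁, F₁, hB₁, hF₁, hc₁, he₁, hn₁⟩ := hdata h₁
    obtain ⟨B₂, F₂, hB₂, hF₂, hc₂, he₂, hn₂⟩ := hdata h₂
    exact hK₁ B₁ B₂ F₁ F₂ u₁ u₂ t ht hc₁ hc₂ he₁ he₂ hn₁ hn₂
      (hFle (hF₁.sub hF₂) (h₁.source_bounded.meas.sub h₂.source_bounded.meas) ht hg)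
      (hBle (hB₁.sub hB₂) (h₁.coeff_bounded.meas.sub h₂.coeff_bounded.meas) ht ha)
  · intro a₀ a₁ a₂ g₀ g₁ g₂ u₀ u₁ u₂ t ht h₀ h₁ h₂ ha₁ ha₂ hg₁ hg₂ ha hg
    obtain ⟨B₀, F₀, hB₀, hF₀, hc₀, he₀, hn₀⟩ := hdata h₀
    obtain ⟨B₁, F₁, hB₁, hF₁, hc₁, he₁, hn₁⟩ := hdata h₁
    obtain ⟨B₂, F₂, hB₂, hF₂, hc₂, he₂, hn₂⟩ := hdata h₂
    have ma₀ := h₀.coeff_bounded.meas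
    have ma₁ := h₁.coeff_bounded.meas
    have ma₂ := h₂.coeff_bounded.meas
    have mg₀ := h₀.source_bounded.meas
    have mg₁ := h₁.source_bounded.meas
    have mg₂ := h₂.source_bounded.meas
    exact hK₂ B₀ B₁ B₂ F₀ F₁ F₂ u₀ u₁ u₂ t ht hc₀ hc₁ hc₂ he₀ he₁ he₂ hn₀ hn₁ hn₂
      (hFle (hF₁.sub hF₀) (mg₁.sub mg₀) ht hg₁) (hBle (hB₁.sub hB₀) (ma₁.sub ma₀) ht ha₁)
      (hFle (hF₂.sub hF₀) (mg₂.sub mg₀) ht hg₂) (hBle (hB₂.sub hB₀) (ma₂.sub ma₀) ht ha₂)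
      (hFle ((hF₁.add hF₂).sub (hF₀.smul 2)) ((mg₁.add mg₂).sub (mg₀.const_smul (2 : ℝ)))
        (sq_nonneg t) hg)
      (hBle ((hB₁.add hB₂).sub (hB₀.smul 2)) ((ma₁.add ma₂).sub (ma₀.const_smul (2 : ℝ)))
        (sq_nonneg t) ha)

end DomainUQ

namespace DomainUQ

variable {d : ℕ} {Dref : Set (EuclideanSpace ℝ (Fin d))}
  {ψ : ℕ → EuclideanSpace ℝ (Fin d) → EuclideanSpace ℝ (Fin d)}

/-! ### The perturbation field as a function of the sines -/

/-- The `k`-th coordinate `sin (2 π y_k)` through which the field depends on the parameter. -/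
noncomputable def signal (y : ParamSet) (k : ℕ) : ℝ := Real.sin (2 * Real.pi * (y k : ℝ))

theorem abs_signal_le_one (y : ParamSet) (k : ℕ) : |signal y k| ≤ 1 := Real.abs_sin_le_one _

theorem exists_signal_eq {z : ℕ → ℝ} (hz : ∀ k, |z k| ≤ 1) : ∃ y : ParamSet, signal y = z := by
  have h : ∀ k, ∃ t : unitInterval, Real.sin (2 * Real.pi * (t : ℝ)) = z k := by
    intro k
    have hk := abs_le.1 (hz k)
    have hpi := Real.pi_pos
    -- `arcsin` takes values in `[-π/2, π/2]`; adding `2π` to negative angles moves them to `[0, 2π]`.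
    rcases le_or_gt 0 (Real.arcsin (z k)) with h0 | h0
    · have h1 := Real.arcsin_le_pi_div_two (z k)
      refine ⟨⟨Real.arcsin (z k) / (2 * Real.pi), by positivity, ?_⟩, ?_⟩
      · rw [div_le_one (by positivity)]
        linarith
      · have : 2 * Real.pi * (Real.arcsin (z k) / (2 * Real.pi)) = Real.arcsin (z k) := by
          field_simp
        simp only [this, Real.sin_arcsin hk.1 hk.2]
    · have h1 := Real.neg_pi_div_two_le_arcsin (z k)
      refine ⟨⟨(Real.arcsin (z k) + 2 * Real.pi) / (2 * Real.pi), ?_, ?_⟩, ?_⟩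
      · exact div_nonneg (by linarith) (by positivity)
      · rw [div_le_one (by positivity)]
        linarith
      · have : 2 * Real.pi * ((Real.arcsin (z k) + 2 * Real.pi) / (2 * Real.pi)) =
            Real.arcsin (z k) + 2 * Real.pi := by field_simp
        simp only [this, Real.sin_add_two_pi, Real.sin_arcsin hk.1 hk.2]
  choose y hy using h
  exact ⟨y, funext hy⟩

theorem contDiffOn_fluctuation (hReg : FieldRegular Dref ψ) (k : ℕ) :
    ContDiffOn ℝ 2 (ψ k) Dref := by
  obtain ⟨y, hy⟩ := exists_signal_eq (z := Pi.single k 1) (fun j => by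
    rcases eq_or_ne j k with rfl | h
    · simp
    · simp [h])
  have hf : ∀ x, field ψ y x = x + (1 / √6 : ℝ) • ψ k x := by
    intro x
    have hs : ∀ j, Real.sin (2 * Real.pi * (y j : ℝ)) = Pi.single (M := fun _ => ℝ) k 1 j :=
      fun j => congrFun hy j
    rw [field, tsum_eq_single k]
    · rw [hs k]; simp
    · intro j hj
      rw [hs j]; simp [hj]
  have h1 : ψ k = fun x => √6 • (field ψ y x - x) := by
    funext x
    have h6 : (√6 : ℝ) ≠ 0 := by positivity
    rw [hf x, add_sub_cancel_left, smul_smul, mul_one_div_cancel h6, one_smul]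
  rw [h1]
  exact (((hReg y).2.mono subset_closure).sub contDiffOn_id).const_smul _

/-- The essential supremum over an open set of a continuous function bounds every value. -/
theorem enorm_le_eLpNorm_top_of_continuousOn {F : Type*} [NormedAddCommGroup F]
    {Ω : Set (EuclideanSpace ℝ (Fin d))} (hΩ : IsOpen Ω) {g : EuclideanSpace ℝ (Fin d) → F}
    (hg : ContinuousOn g Ω) {x : EuclideanSpace ℝ (Fin d)} (hx : x ∈ Ω) :
    ‖g x‖ₑ ≤ eLpNorm g ⊤ (volume.restrict Ω) := by
  by_contra! hlt
  have hopen : IsOpen (Ω ∩ (fun x => ‖g x‖ₑ) ⁻¹' Set.Ioi (eLpNorm g ⊤ (volume.restrict Ω))) :=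
    (continuous_enorm.comp_continuousOn hg).isOpen_inter_preimage hΩ isOpen_Ioi
  have hzero : volume (Ω ∩ (fun x => ‖g x‖ₑ) ⁻¹' Set.Ioi (eLpNorm g ⊤ (volume.restrict Ω))) = 0 := by
    have h := ae_le_eLpNormEssSup (f := g) (μ := volume.restrict Ω)
    rw [← eLpNorm_exponent_top, ae_restrict_iff' hΩ.measurableSet] at h
    refine measure_mono_null ?_ h
    rintro z ⟨hz, hz'⟩ hcon
    exact absurd (hcon hz) (not_le.2 hz')
  have := hopen.eq_empty_of_measure_zero hzero
  exact absurd (show x ∈ (∅ : Set _) from this ▸ ⟨hx, hlt⟩) (Set.notMem_empty x)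

/-- The `W^{1,∞}` norm of the `k`-th fluctuation as a real number. -/
noncomputable def fluctuationNorm (Dref : Set (EuclideanSpace ℝ (Fin d)))
    (ψ : ℕ → EuclideanSpace ℝ (Fin d) → EuclideanSpace ℝ (Fin d)) (k : ℕ) : ℝ :=
  (wOneInftyNorm Dref (ψ k)).toReal

theorem fluctuationNorm_nonneg (k : ℕ) : 0 ≤ fluctuationNorm Dref ψ k := ENNReal.toReal_nonneg

theorem summable_fluctuationNorm (hSum : FluctuationsSummable Dref ψ) :
    Summable (fluctuationNorm Dref ψ) := ENNReal.summable_toReal hSum.2.ne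

/-- The value and the Jacobian matrix of the `k`-th fluctuation. -/
noncomputable def fluctuationJet
    (ψ : ℕ → EuclideanSpace ℝ (Fin d) → EuclideanSpace ℝ (Fin d)) (k : ℕ)
    (x : EuclideanSpace ℝ (Fin d)) : EuclideanSpace ℝ (Fin d) × (Fin d → Fin d → ℝ) :=
  (ψ k x, fun i j => jacobian (ψ k) x i j)

/-- The value `V(x,y)` and the Jacobian matrix `J(x,y)` of the perturbation field. -/
noncomputable def fieldJet
    (ψ : ℕ → EuclideanSpace ℝ (Fin d) → EuclideanSpace ℝ (Fin d)) (y : ParamSet)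
    (x : EuclideanSpace ℝ (Fin d)) : EuclideanSpace ℝ (Fin d) × (Fin d → Fin d → ℝ) :=
  (field ψ y x, fun i j => fieldJacobian ψ y x i j)

theorem norm_fluctuationJet_le (hΩ : IsOpen Dref) (hReg : FieldRegular Dref ψ)
    (hSum : FluctuationsSummable Dref ψ) (k : ℕ) {x : EuclideanSpace ℝ (Fin d)} (hx : x ∈ Dref) :
    ‖fluctuationJet ψ k x‖ ≤ fluctuationNorm Dref ψ k := by
  have hc := contDiffOn_fluctuation hReg k
  have h1 : ‖ψ k x‖ ≤ fluctuationNorm Dref ψ k := by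
    have h := (enorm_le_eLpNorm_top_of_continuousOn hΩ hc.continuousOn hx).trans
      (le_max_left _ (eLpNorm (fderiv ℝ (ψ k)) ⊤ (volume.restrict Dref)))
    simpa [fluctuationNorm] using ENNReal.toReal_mono (hSum.1 k).ne h
  have h2 : ‖fderiv ℝ (ψ k) x‖ ≤ fluctuationNorm Dref ψ k := by
    have h := (enorm_le_eLpNorm_top_of_continuousOn hΩ
      (hc.continuousOn_fderiv_of_isOpen hΩ (by norm_num)) hx).trans
      (le_max_right (eLpNorm (ψ k) ⊤ (volume.restrict Dref)) _)
    simpa [fluctuationNorm] using ENNReal.toReal_mono (hSum.1 k).ne h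
  refine norm_prod_le_iff.2 ⟨h1, ?_⟩
  refine (pi_norm_le_iff_of_nonneg (fluctuationNorm_nonneg k)).2 fun i =>
    (pi_norm_le_iff_of_nonneg (fluctuationNorm_nonneg k)).2 fun j => ?_
  calc ‖fderiv ℝ (ψ k) x (EuclideanSpace.single j 1) i‖
      ≤ ‖fderiv ℝ (ψ k) x (EuclideanSpace.single j 1)‖ := PiLp.norm_apply_le _ i
    _ ≤ ‖fderiv ℝ (ψ k) x‖ * ‖EuclideanSpace.single j (1 : ℝ)‖ := ContinuousLinearMap.le_opNorm _ _
    _ ≤ fluctuationNorm Dref ψ k := by simpa using h2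

theorem continuousOn_fluctuationJet (hΩ : IsOpen Dref) (hReg : FieldRegular Dref ψ) (k : ℕ) :
    ContinuousOn (fluctuationJet ψ k) Dref := by
  have hc := contDiffOn_fluctuation hReg k
  have hd := hc.continuousOn_fderiv_of_isOpen hΩ (by norm_num)
  refine hc.continuousOn.prodMk (continuousOn_pi.2 fun i => continuousOn_pi.2 fun j => ?_)
  have h1 : ContinuousOn (fun x => fderiv ℝ (ψ k) x (EuclideanSpace.single j 1)) Dref :=
    hd.clm_apply continuousOn_const
  exact (by fun_prop : Continuous fun v : EuclideanSpace ℝ (Fin d) => v i).comp_continuousOn h1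

theorem norm_signal_smul_fluctuationJet_le (hΩ : IsOpen Dref) (hReg : FieldRegular Dref ψ)
    (hSum : FluctuationsSummable Dref ψ) (y : ParamSet) (k : ℕ) {x : EuclideanSpace ℝ (Fin d)}
    (hx : x ∈ Dref) : ‖signal y k • fluctuationJet ψ k x‖ ≤ fluctuationNorm Dref ψ k := by
  rw [norm_smul]
  exact (mul_le_of_le_one_left (norm_nonneg _) (abs_signal_le_one y k)).trans
    (norm_fluctuationJet_le hΩ hReg hSum k hx)

theorem summable_signal_smul_fluctuationJet (hΩ : IsOpen Dref) (hReg : FieldRegular Dref ψ)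
    (hSum : FluctuationsSummable Dref ψ) (y : ParamSet) {x : EuclideanSpace ℝ (Fin d)}
    (hx : x ∈ Dref) : Summable fun k => signal y k • fluctuationJet ψ k x :=
  .of_norm_bounded (summable_fluctuationNorm hSum)
    fun k => norm_signal_smul_fluctuationJet_le hΩ hReg hSum y k hx

theorem fieldJet_eq (hΩ : IsOpen Dref) (hReg : FieldRegular Dref ψ)
    (hSum : FluctuationsSummable Dref ψ) (y : ParamSet) {x : EuclideanSpace ℝ (Fin d)}
    (hx : x ∈ Dref) : fieldJet ψ y x = (x, fun i j => (1 : Matrix (Fin d) (Fin d) ℝ) i j) +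
      (1 / √6 : ℝ) • ∑' k, signal y k • fluctuationJet ψ k x := by
  have hs := (summable_signal_smul_fluctuationJet hΩ hReg hSum y hx).hasSum
  have h1 := hs.map (ContinuousLinearMap.fst ℝ _ _) (ContinuousLinearMap.continuous _)
  have h2 := hs.map (ContinuousLinearMap.snd ℝ _ _) (ContinuousLinearMap.continuous _)
  set T := ∑' k, signal y k • fluctuationJet ψ k x
  have h3 : HasSum (fun k => signal y k • jacobian (ψ k) x)
      (Matrix.of T.2 : Matrix (Fin d) (Fin d) ℝ) :=
    Pi.hasSum.2 fun i => Pi.hasSum.2 fun j => Pi.hasSum.1 (Pi.hasSum.1 h2 i) j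
  refine Prod.ext ?_ ?_
  · change x + (1 / √6 : ℝ) • ∑' k, signal y k • ψ k x = x + (1 / √6 : ℝ) • T.1
    congr 2
    exact h1.tsum_eq
  · have h4 : fieldJacobian ψ y x = 1 + (1 / √6 : ℝ) • Matrix.of T.2 := by
      change 1 + (1 / √6 : ℝ) • ∑' k, signal y k • jacobian (ψ k) x = _
      rw [h3.tsum_eq]
    change (fun i j => fieldJacobian ψ y x i j) = _
    rw [h4]
    rfl

theorem continuousOn_fieldJet (hΩ : IsOpen Dref) (hReg : FieldRegular Dref ψ)
    (hSum : FluctuationsSummable Dref ψ) (y : ParamSet) : ContinuousOn (fieldJet ψ y) Dref := by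
  have h : ContinuousOn (fun x => ((x, fun i j => (1 : Matrix (Fin d) (Fin d) ℝ) i j) :
      EuclideanSpace ℝ (Fin d) × (Fin d → Fin d → ℝ)) +
      (1 / √6 : ℝ) • ∑' k, signal y k • fluctuationJet ψ k x) Dref := by
    have ht : ContinuousOn (fun x => ∑' k, signal y k • fluctuationJet ψ k x) Dref :=
      continuousOn_tsum (fun k => (continuousOn_fluctuationJet hΩ hReg k).const_smul
        (signal y k))
        (summable_fluctuationNorm hSum)
        fun k x hx => norm_signal_smul_fluctuationJet_le hΩ hReg hSum y k hx
    exact (continuousOn_id.prodMk continuousOn_const).add (ht.const_smul (1 / √6 : ℝ))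
  exact h.congr fun x hx => fieldJet_eq hΩ hReg hSum y hx

theorem fieldJet_combination (hΩ : IsOpen Dref) (hReg : FieldRegular Dref ψ)
    (hSum : FluctuationsSummable Dref ψ) {y y₁ y₂ : ParamSet} {a b : ℝ} (hab : a + b = 1)
    (hy : ∀ k, signal y k = a * signal y₁ k + b * signal y₂ k) {x : EuclideanSpace ℝ (Fin d)}
    (hx : x ∈ Dref) : fieldJet ψ y x = a • fieldJet ψ y₁ x + b • fieldJet ψ y₂ x := by
  have hs₁ := summable_signal_smul_fluctuationJet hΩ hReg hSum y₁ hx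
  have hs₂ := summable_signal_smul_fluctuationJet hΩ hReg hSum y₂ hx
  have h : ∑' k, signal y k • fluctuationJet ψ k x =
      a • ∑' k, signal y₁ k • fluctuationJet ψ k x +
      b • ∑' k, signal y₂ k • fluctuationJet ψ k x := by
    rw [← hs₁.tsum_const_smul, ← hs₂.tsum_const_smul,
      ← (hs₁.const_smul a).tsum_add (hs₂.const_smul b)]
    refine tsum_congr fun k => ?_
    rw [hy k]
    module
  rw [fieldJet_eq hΩ hReg hSum y hx, fieldJet_eq hΩ hReg hSum y₁ hx,
    fieldJet_eq hΩ hReg hSum y₂ hx, h]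
  set e : EuclideanSpace ℝ (Fin d) × (Fin d → Fin d → ℝ) :=
    (x, fun i j => (1 : Matrix (Fin d) (Fin d) ℝ) i j)
  obtain rfl : b = 1 - a := by linarith
  module

/-- The values of the jet at a point, over all parameters, form a convex set: the sines of the
parameters fill the cube `[-1,1]^ℕ`, and the jet is an affine function of the sines. -/
theorem segment_fieldJet_subset (hΩ : IsOpen Dref) (hReg : FieldRegular Dref ψ)
    (hSum : FluctuationsSummable Dref ψ) (y₁ y₂ : ParamSet) {x : EuclideanSpace ℝ (Fin d)}
    (hx : x ∈ Dref) :
    segment ℝ (fieldJet ψ y₁ x) (fieldJet ψ y₂ x) ⊆ Set.range fun y => fieldJet ψ y x := by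
  rintro _ ⟨a, b, ha, hb, hab, rfl⟩
  obtain ⟨y, hy⟩ := exists_signal_eq (z := fun k => a * signal y₁ k + b * signal y₂ k) fun k => by
    have h := (convex_Icc (-1 : ℝ) 1) (abs_le.1 (abs_signal_le_one y₁ k))
      (abs_le.1 (abs_signal_le_one y₂ k)) ha hb hab
    exact abs_le.2 h
  exact ⟨y, fieldJet_combination hΩ hReg hSum hab (fun k => congrFun hy k) hx⟩

/-- The weighted distance `∑ |sin (2 π y_k) - sin (2 π y'_k)| b_k` of two parameters. -/
noncomputable def signalDist (b : ℕ → ℝ) (y y' : ParamSet) : ℝ :=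
  ∑' k, |signal y k - signal y' k| * b k

theorem abs_signal_sub_le_two (y y' : ParamSet) (k : ℕ) : |signal y k - signal y' k| ≤ 2 := by
  have h1 := abs_le.1 (abs_signal_le_one y k)
  have h2 := abs_le.1 (abs_signal_le_one y' k)
  exact abs_le.2 ⟨by linarith, by linarith⟩

theorem norm_fieldJet_sub_le (hΩ : IsOpen Dref) (hReg : FieldRegular Dref ψ)
    (hSum : FluctuationsSummable Dref ψ) (y y' : ParamSet) {x : EuclideanSpace ℝ (Fin d)}
    (hx : x ∈ Dref) : ‖fieldJet ψ y x - fieldJet ψ y' x‖ ≤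
      signalDist (fluctuationNorm Dref ψ) y y' := by
  have hs := summable_signal_smul_fluctuationJet hΩ hReg hSum y hx
  have hs' := summable_signal_smul_fluctuationJet hΩ hReg hSum y' hx
  have h : fieldJet ψ y x - fieldJet ψ y' x =
      (1 / √6 : ℝ) • ∑' k, (signal y k - signal y' k) • fluctuationJet ψ k x := by
    rw [fieldJet_eq hΩ hReg hSum y hx, fieldJet_eq hΩ hReg hSum y' hx, add_sub_add_left_eq_sub,
      ← smul_sub, ← hs.tsum_sub hs']
    simp only [sub_smul]
  have h6 : ‖(1 / √6 : ℝ)‖ ≤ 1 := by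
    rw [Real.norm_of_nonneg (by positivity), div_le_one (by positivity)]
    exact Real.one_le_sqrt.2 (by norm_num)
  have hsum : Summable fun k => |signal y k - signal y' k| * fluctuationNorm Dref ψ k :=
    .of_nonneg_of_le (fun k => mul_nonneg (abs_nonneg _) (fluctuationNorm_nonneg k))
      (fun k => mul_le_mul_of_nonneg_right (abs_signal_sub_le_two y y' k)
        (fluctuationNorm_nonneg k)) ((summable_fluctuationNorm hSum).mul_left 2)
  rw [h, norm_smul]
  refine (mul_le_of_le_one_left (norm_nonneg _) h6).trans ?_
  refine tsum_of_norm_bounded hsum.hasSum fun k => ?_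
  rw [norm_smul]
  exact mul_le_mul_of_nonneg_left (norm_fluctuationJet_le hΩ hReg hSum k hx) (abs_nonneg _)

variable {f : EuclideanSpace ℝ (Fin d) → ℝ}

/-! ### Uniform bounds for the transported data -/

/-- The determinant of `J(x,y)` is bounded below by a positive constant: its absolute value is, and it
is positive, since `J(x,y)` is joined to the identity matrix by a segment of invertible Jacobian
matrices. -/
theorem pow_le_det_fieldJacobian (hΩ : IsOpen Dref) (hReg : FieldRegular Dref ψ)
    (hSum : FluctuationsSummable Dref ψ) {σ : ℝ} (hσ : 0 < σ)
    (hJ : ∀ x ∈ Dref, ∀ y : ParamSet, ∀ t ∈ singularValues (fieldJacobian ψ y x), σ ≤ t)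
    (y : ParamSet) {x : EuclideanSpace ℝ (Fin d)} (hx : x ∈ Dref) :
    σ ^ d ≤ (fieldJacobian ψ y x).det := by
  have habs : ∀ y, σ ^ d ≤ |(fieldJacobian ψ y x).det| := fun y =>
    pow_le_abs_det_of_le_singularValues hσ.le (hJ x hx y)
  obtain ⟨y₀, hy₀⟩ := exists_signal_eq (z := 0) (by simp)
  have hid : fieldJacobian ψ y₀ x = 1 := by
    have hs : ∀ j, Real.sin (2 * Real.pi * (y₀ j : ℝ)) = 0 := fun j => congrFun hy₀ j
    simp [fieldJacobian, hs]
  have hcont : Continuous fun a : EuclideanSpace ℝ (Fin d) × (Fin d → Fin d → ℝ) =>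
      (Matrix.of a.2).det :=
    (contDiff_det (n := 0) fun _ _ => contDiff_entry _ _).continuous.comp continuous_snd
  -- A sign change along the segment to the identity would produce a singular Jacobian matrix.
  by_contra! hlt
  have hneg : (fieldJacobian ψ y x).det < 0 := by
    by_contra! h0
    have := habs y
    rw [abs_of_nonneg h0] at this
    linarith
  have hconn : IsPreconnected (segment ℝ (fieldJet ψ y x) (fieldJet ψ y₀ x)) :=
    (convex_segment _ _).isPreconnected
  have hmem : (0 : ℝ) ∈ (fun a : EuclideanSpace ℝ (Fin d) × (Fin d → Fin d → ℝ) =>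
      (Matrix.of a.2).det) '' segment ℝ (fieldJet ψ y x) (fieldJet ψ y₀ x) := by
    refine hconn.intermediate_value (left_mem_segment ℝ _ _) (right_mem_segment ℝ _ _)
      hcont.continuousOn ⟨?_, ?_⟩
    · exact hneg.le
    · change 0 ≤ (fieldJacobian ψ y₀ x).det
      rw [hid, Matrix.det_one]
      exact zero_le_one
  obtain ⟨w, hw, hw0⟩ := hmem
  obtain ⟨y', rfl⟩ := segment_fieldJet_subset hΩ hReg hSum y y₀ hx hw
  have h := habs y'
  have h0 : (fieldJacobian ψ y' x).det = 0 := hw0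
  rw [h0, abs_zero] at h
  exact absurd h (not_le.2 (by positivity))

/-- The jets of the field at points of the reference domain lie in the product of the closed
hold-all domain with a compact set of invertible matrices. -/
theorem exists_fieldJet_mem (hΩ : IsOpen Dref) (hb : Bornology.IsBounded Dref)
    (hReg : FieldRegular Dref ψ) (hJac : JacobianUniformlyBounded Dref ψ)
    (hSum : FluctuationsSummable Dref ψ) :
    IsCompact (closure (holdAll Dref ψ)) ∧ ∃ R δ : ℝ, 0 < δ ∧ ∀ y, ∀ x ∈ Dref,
      fieldJet ψ y x ∈ closure (holdAll Dref ψ) ×ˢ boundedMatrices d R δ := by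
  obtain ⟨σ, _, hσ, _, _, hJ⟩ := hJac
  obtain ⟨ρ, hρ⟩ := hb.exists_norm_le
  set S := ∑' k, fluctuationNorm Dref ψ k
  obtain ⟨y₀, hy₀⟩ := exists_signal_eq (z := 0) (by simp)
  have hbound : ∀ y, ∀ x ∈ Dref,
      ‖fieldJet ψ y x - (x, fun i j => (1 : Matrix (Fin d) (Fin d) ℝ) i j)‖ ≤ S := by
    intro y x hx
    have h0 : fieldJet ψ y₀ x = (x, fun i j => (1 : Matrix (Fin d) (Fin d) ℝ) i j) := by
      rw [fieldJet_eq hΩ hReg hSum y₀ hx]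
      simp [hy₀]
    rw [← h0]
    refine (norm_fieldJet_sub_le hΩ hReg hSum y y₀ hx).trans ?_
    have hle : ∀ k, |signal y k - signal y₀ k| * fluctuationNorm Dref ψ k ≤
        fluctuationNorm Dref ψ k := fun k => by
      refine mul_le_of_le_one_left (fluctuationNorm_nonneg k) ?_
      rw [hy₀, Pi.zero_apply, sub_zero]
      exact abs_signal_le_one y k
    have hs := summable_fluctuationNorm hSum
    exact (Summable.of_nonneg_of_le
      (fun k => mul_nonneg (abs_nonneg _) (fluctuationNorm_nonneg k)) hle hs).tsum_le_tsum hle hs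
  refine ⟨?_, 1 + S, σ ^ d, by positivity, fun y x hx => ⟨?_, ?_, ?_⟩⟩
  · refine Bornology.IsBounded.isCompact_closure ?_
    refine isBounded_iff_forall_norm_le.2 ⟨ρ + S, fun w hw => ?_⟩
    obtain ⟨y, hy⟩ := Set.mem_iUnion.1 hw
    obtain ⟨x, hx, rfl⟩ := hy
    have h1 : ‖field ψ y x - x‖ ≤ S := (norm_fst_le _).trans (hbound y x hx)
    calc ‖field ψ y x‖ = ‖x + (field ψ y x - x)‖ := by rw [add_sub_cancel]
      _ ≤ ρ + S := (norm_add_le _ _).trans (add_le_add (hρ x hx) h1)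
  · exact subset_closure (Set.mem_iUnion.2 ⟨y, x, hx, rfl⟩)
  · intro i j
    have h1 := (norm_snd_le _).trans (hbound y x hx)
    have h2 : |fieldJacobian ψ y x i j - (1 : Matrix (Fin d) (Fin d) ℝ) i j| ≤ S :=
      ((norm_le_pi_norm ((fieldJet ψ y x -
        (x, fun i j => (1 : Matrix (Fin d) (Fin d) ℝ) i j)).2 i) j).trans
          (norm_le_pi_norm _ i)).trans h1
    have h3 : |(1 : Matrix (Fin d) (Fin d) ℝ) i j| ≤ 1 := by
      rw [Matrix.one_apply]
      split_ifs <;> simp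
    calc |fieldJacobian ψ y x i j| = |(1 : Matrix (Fin d) (Fin d) ℝ) i j +
          (fieldJacobian ψ y x i j - (1 : Matrix (Fin d) (Fin d) ℝ) i j)| := by
            rw [add_sub_cancel]
      _ ≤ 1 + S := (abs_add_le _ _).trans (add_le_add h3 h2)
  · exact pow_le_det_fieldJacobian hΩ hReg hSum hσ (fun x hx y t ht => (hJ x hx y t ht).1) y hx


/-- A `C²` function of the jet of the field is bounded, has first differences bounded by the
distance of the parameters, and second differences bounded by its square. -/
theorem exists_bound_comp_fieldJet (hΩ : IsOpen Dref) (hReg : FieldRegular Dref ψ)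
    (hSum : FluctuationsSummable Dref ψ)
    {K : Set (EuclideanSpace ℝ (Fin d) × (Fin d → Fin d → ℝ))} (hK : IsCompact K)
    (hmem : ∀ y, ∀ x ∈ Dref, fieldJet ψ y x ∈ K) {F : Type*} [NormedAddCommGroup F]
    [NormedSpace ℝ F] {h : EuclideanSpace ℝ (Fin d) × (Fin d → Fin d → ℝ) → F}
    (hh : ∀ w ∈ K, ContDiffAt ℝ 2 h w) :
    ∃ C, 0 ≤ C ∧ (∀ y, BoundedOn Dref (fun x => h (fieldJet ψ y x)) C) ∧
      (∀ y₁ y₂, ∀ x ∈ Dref, ‖h (fieldJet ψ y₁ x) - h (fieldJet ψ y₂ x)‖ ≤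
        C * signalDist (fluctuationNorm Dref ψ) y₁ y₂) ∧
      ∀ y₀ y₁ y₂, (∀ k, signal y₁ k + signal y₂ k = 2 * signal y₀ k) → ∀ x ∈ Dref,
        ‖h (fieldJet ψ y₁ x) + h (fieldJet ψ y₂ x) - (2 : ℝ) • h (fieldJet ψ y₀ x)‖ ≤
          C * signalDist (fluctuationNorm Dref ψ) y₁ y₂ ^ 2 := by
  obtain ⟨C₁, hC₁⟩ := hK.exists_bound_of_continuousOn (f := h)
    fun w hw => (hh w hw).continuousAt.continuousWithinAt
  obtain ⟨C₂, hC₂, hdiff⟩ := exists_bound_first_second_difference hK hh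
  have hsub : ∀ y₁ y₂, ∀ x ∈ Dref, segment ℝ (fieldJet ψ y₁ x) (fieldJet ψ y₂ x) ⊆ K := by
    intro y₁ y₂ x hx w hw
    obtain ⟨y, rfl⟩ := segment_fieldJet_subset hΩ hReg hSum y₁ y₂ hx hw
    exact hmem y x hx
  refine ⟨max C₁ C₂, hC₂.trans (le_max_right _ _), fun y => ⟨?_, fun x hx => ?_,
    hC₂.trans (le_max_right _ _)⟩, fun y₁ y₂ x hx => ?_, fun y₀ y₁ y₂ hy x hx => ?_⟩
  · refine ContinuousOn.aestronglyMeasurable ?_ hΩ.measurableSet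
    have hc : ContinuousOn h K := fun w hw => (hh w hw).continuousAt.continuousWithinAt
    exact hc.comp (continuousOn_fieldJet hΩ hReg hSum y) fun x hx => hmem y x hx
  · exact (hC₁ _ (hmem y x hx)).trans (le_max_left _ _)
  · refine (hdiff _ _ (hsub y₁ y₂ x hx)).1.trans ?_
    exact mul_le_mul (le_max_right _ _) (norm_fieldJet_sub_le hΩ hReg hSum y₁ y₂ hx)
      (norm_nonneg _) (hC₂.trans (le_max_right _ _))
  · have hmid : midpoint ℝ (fieldJet ψ y₁ x) (fieldJet ψ y₂ x) = fieldJet ψ y₀ x := by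
      rw [fieldJet_combination hΩ hReg hSum (y := y₀) (y₁ := y₁) (y₂ := y₂) (a := 1 / 2)
        (b := 1 / 2) (by norm_num) (fun k => by linarith [hy k]) hx, midpoint_eq_smul_add,
        invOf_eq_inv, smul_add, one_div]
    have h2 := (hdiff _ _ (hsub y₁ y₂ x hx)).2
    rw [hmid] at h2
    refine h2.trans ?_
    have := norm_fieldJet_sub_le hΩ hReg hSum y₁ y₂ hx
    gcongr
    exact le_max_right _ _

theorem contDiffAt_source {K : Set (EuclideanSpace ℝ (Fin d))} (hf : AnalyticOnNhd ℝ f K)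
    {w : EuclideanSpace ℝ (Fin d) × (Fin d → Fin d → ℝ)} (hw : w.1 ∈ K) :
    ContDiffAt ℝ 2 (fun w : EuclideanSpace ℝ (Fin d) × (Fin d → Fin d → ℝ) =>
      f w.1 * (Matrix.of w.2).det) w := by
  have h1 : ContDiffAt ℝ 2 f w.1 := (hf w.1 hw).contDiffAt
  have h2 : ContDiff ℝ 2 fun a : Fin d → Fin d → ℝ => (Matrix.of a).det :=
    contDiff_det fun _ _ => contDiff_entry _ _
  exact (h1.comp w contDiffAt_fst).mul (h2.comp contDiff_snd).contDiffAt

end DomainUQ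

namespace DomainUQ

/-! ### Averaging over the parameters -/

instance : IsProbabilityMeasure paramMeasure := by
  unfold paramMeasure
  infer_instance

/-- Reflection `y_i ↦ 1 - y_i` of a single parameter. -/
def reflect (i : ℕ) (y : ParamSet) : ParamSet :=
  fun j => (if j = i then unitInterval.symm else id) (y j)

theorem measurePreserving_reflect (i : ℕ) :
    MeasurePreserving (reflect i) paramMeasure paramMeasure := by
  have hf : ∀ j, MeasurePreserving (if j = i then unitInterval.symm else id)
      (volume : Measure unitInterval) volume := by
    intro j
    split_ifs
    · exact unitInterval.measurePreserving_symm
    · exact MeasurePreserving.id _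
  refine ⟨measurable_pi_lambda _ fun j => (hf j).measurable.comp (measurable_pi_apply j), ?_⟩
  have h := Measure.infinitePi_map_pi (μ := fun _ : ℕ => (volume : Measure unitInterval))
    (fun j => (hf j).measurable)
  simp only [(hf _).map_eq] at h
  exact h

theorem signal_reflect_self (i : ℕ) (y : ParamSet) : signal (reflect i y) i = -signal y i := by
  have : 2 * Real.pi * (1 - (y i : ℝ)) = 2 * Real.pi - 2 * Real.pi * (y i : ℝ) := by ring
  simp [signal, reflect, this, Real.sin_two_pi_sub]

theorem signal_reflect_of_ne {i j : ℕ} (h : j ≠ i) (y : ParamSet) :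
    signal (reflect i y) j = signal y j := by
  simp [signal, reflect, h]

theorem signal_truncate (s : ℕ) (y : ParamSet) (k : ℕ) :
    signal (truncate s y) k = if k < s then signal y k else 0 := by
  unfold signal truncate
  split_ifs <;> simp

theorem continuous_signal (k : ℕ) : Continuous fun y => signal y k := by
  unfold signal
  fun_prop

theorem continuous_truncate (s : ℕ) : Continuous (truncate s) := by
  refine continuous_pi fun i => ?_
  unfold truncate
  split_ifs
  · exact continuous_apply i
  · exact continuous_const

variable {b : ℕ → ℝ}

theorem summable_signalDist (hb0 : ∀ k, 0 ≤ b k) (hb : Summable b) (y y' : ParamSet) :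
    Summable fun k => |signal y k - signal y' k| * b k :=
  .of_nonneg_of_le (fun k => mul_nonneg (abs_nonneg _) (hb0 k))
    (fun k => mul_le_mul_of_nonneg_right (abs_signal_sub_le_two y y' k) (hb0 k)) (hb.mul_left 2)

theorem signalDist_nonneg (hb0 : ∀ k, 0 ≤ b k) (y y' : ParamSet) : 0 ≤ signalDist b y y' :=
  tsum_nonneg fun k => mul_nonneg (abs_nonneg _) (hb0 k)

theorem continuous_signalDist (hb0 : ∀ k, 0 ≤ b k) (hb : Summable b) (y' : ParamSet) :
    Continuous fun y => signalDist b y y' := by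
  refine continuous_tsum (fun k => (((continuous_signal k).sub continuous_const).abs).mul
    continuous_const) (hb.mul_left 2) fun k y => ?_
  rw [Real.norm_of_nonneg (mul_nonneg (abs_nonneg _) (hb0 k))]
  exact mul_le_mul_of_nonneg_right (abs_signal_sub_le_two y y' k) (hb0 k)

theorem signalDist_le_of_eq {y y' : ParamSet} {i : ℕ} {c : ℝ} (hb0 : ∀ k, 0 ≤ b k)
    (hne : ∀ k, k ≠ i → signal y k = signal y' k) (hc : |signal y i - signal y' i| ≤ c) :
    signalDist b y y' ≤ c * b i := by
  rw [signalDist, tsum_eq_single i fun k hk => by rw [hne k hk, sub_self, abs_zero, zero_mul]]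
  exact mul_le_mul_of_nonneg_right hc (hb0 i)

theorem signalDist_truncate_le (hb0 : ∀ k, 0 ≤ b k) (hb : Summable b) (n : ℕ) (y : ParamSet) :
    signalDist b y (truncate n y) ≤ ∑' k, b (k + n) := by
  have hs := summable_signalDist hb0 hb y (truncate n y)
  rw [signalDist, ← hs.sum_add_tsum_nat_add n, Finset.sum_eq_zero, zero_add]
  · refine ((summable_nat_add_iff n).2 hs).tsum_le_tsum (fun k => ?_)
      ((summable_nat_add_iff n).2 hb)
    refine mul_le_of_le_one_left (hb0 _) ?_
    rw [signal_truncate, if_neg (by omega), sub_zero]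
    exact abs_signal_le_one _ _
  · intro k hk
    rw [signal_truncate, if_pos (Finset.mem_range.1 hk), sub_self, abs_zero, zero_mul]

/-- Dimension truncation.  If a function of the parameters is Lipschitz for the weighted distance of
the sines, and its symmetric second differences are quadratic in it, then truncation after `s`
parameters changes its mean by a multiple of `∑_{i ≥ s} b_i²`: switching on the parameter `i` has no
first-order effect on the mean, since `y_i ↦ 1 - y_i` preserves the measure and flips the sign of
`sin (2 π y_i)`. -/
theorem norm_integral_sub_truncate_le {H : Type*} [NormedAddCommGroup H] [NormedSpace ℝ H]
    (hb0 : ∀ k, 0 ≤ b k) (hb : Summable b) {u : ParamSet → H} {K : ℝ} (hK : 0 ≤ K)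
    (hlip : ∀ y y', ‖u y - u y'‖ ≤ K * signalDist b y y')
    (hsec : ∀ y₀ y₁ y₂ t, 0 ≤ t → (∀ k, signal y₁ k + signal y₂ k = 2 * signal y₀ k) →
      signalDist b y₁ y₀ ≤ t → signalDist b y₂ y₀ ≤ t → signalDist b y₁ y₂ ≤ t →
      ‖u y₁ + u y₂ - (2 : ℝ) • u y₀‖ ≤ K * t ^ 2) :
    Integrable u paramMeasure ∧ (∀ s, Integrable (fun y => u (truncate s y)) paramMeasure) ∧
      ∀ s T, (∀ n, ∑ i ∈ Finset.Ico s n, b i ^ 2 ≤ T) →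
        ‖∫ y, (u y - u (truncate s y)) ∂paramMeasure‖ ≤ 2 * K * T := by
  have hcont : Continuous u := by
    refine continuous_iff_continuousAt.2 fun y₀ => ?_
    refine tendsto_iff_norm_sub_tendsto_zero.2 ?_
    have h : Filter.Tendsto (fun y => K * signalDist b y y₀) (nhds y₀) (nhds 0) := by
      have := ((continuous_signalDist hb0 hb y₀).const_mul K).tendsto y₀
      simpa [signalDist] using this
    exact squeeze_zero (fun _ => norm_nonneg _) (fun y => hlip y y₀) h
  have hint : ∀ {v : ParamSet → H}, Continuous v → Integrable v paramMeasure := fun hv =>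
    hv.integrable_of_hasCompactSupport (HasCompactSupport.of_compactSpace _)
  have hcs : ∀ s, Continuous fun y => u (truncate s y) := fun s =>
    hcont.comp (continuous_truncate s)
  refine ⟨hint hcont, fun s => hint (hcs s), fun s T hT => ?_⟩
  have hstep : ∀ i, ‖∫ y, (u (truncate (i + 1) y) - u (truncate i y)) ∂paramMeasure‖ ≤
      2 * K * b i ^ 2 := by
    intro i
    have hrefl : ∫ y, u (truncate (i + 1) (reflect i y)) ∂paramMeasure =
        ∫ y, u (truncate (i + 1) y) ∂paramMeasure := by
      have h := integral_map (measurePreserving_reflect i).aemeasurable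
        (f := fun y => u (truncate (i + 1) y)) (μ := paramMeasure)
        (by rw [(measurePreserving_reflect i).map_eq]; exact (hint (hcs _)).aestronglyMeasurable)
      rw [(measurePreserving_reflect i).map_eq] at h
      exact h.symm
    have hri : Integrable (fun y => u (truncate (i + 1) (reflect i y))) paramMeasure :=
      (measurePreserving_reflect i).integrable_comp_of_integrable (hint (hcs (i + 1)))
    have heq : ∫ y, (u (truncate (i + 1) y) - u (truncate i y)) ∂paramMeasure =
        (1 / 2 : ℝ) • ∫ y, (u (truncate (i + 1) y) + u (truncate (i + 1) (reflect i y)) -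
          (2 : ℝ) • u (truncate i y)) ∂paramMeasure := by
      have h₁ : Integrable (fun y => u (truncate (i + 1) y) +
          u (truncate (i + 1) (reflect i y))) paramMeasure := (hint (hcs _)).add hri
      have h₂ : Integrable (fun y => (2 : ℝ) • u (truncate i y)) paramMeasure :=
        (hint (hcs i)).smul (2 : ℝ)
      rw [integral_sub (hint (hcs _)) (hint (hcs _)), integral_sub h₁ h₂,
        integral_add (hint (hcs _)) hri, hrefl, integral_smul]
      module
    have hpt : ∀ y, ‖u (truncate (i + 1) y) + u (truncate (i + 1) (reflect i y)) -
        (2 : ℝ) • u (truncate i y)‖ ≤ K * (2 * b i) ^ 2 := by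
      intro y
      have hbi := hb0 i
      have h1 := abs_signal_le_one y i
      have hlt : ∀ k, k ≠ i → (k < i + 1 ↔ k < i) := fun k hk => by omega
      refine hsec _ _ _ _ (by positivity) (fun k => ?_) ?_ ?_ ?_
      · simp only [signal_truncate]
        rcases eq_or_ne k i with rfl | hk
        · simp [signal_reflect_self]
        · simp only [hlt k hk, signal_reflect_of_ne hk]
          split_ifs <;> ring
      · refine signalDist_le_of_eq hb0 (fun k hk => ?_) ?_
        · simp only [signal_truncate, hlt k hk]
        · simp only [signal_truncate, lt_irrefl, if_false, Nat.lt_succ_self, if_true, sub_zero]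
          linarith
      · refine signalDist_le_of_eq hb0 (fun k hk => ?_) ?_
        · simp only [signal_truncate, hlt k hk, signal_reflect_of_ne hk]
        · simp only [signal_truncate, lt_irrefl, if_false, Nat.lt_succ_self, if_true, sub_zero,
            signal_reflect_self, abs_neg]
          linarith
      · refine signalDist_le_of_eq hb0 (fun k hk => ?_) (abs_signal_sub_le_two _ _ _)
        simp only [signal_truncate, signal_reflect_of_ne hk]
    rw [heq, norm_smul]
    have h := norm_integral_le_of_norm_le_const (μ := paramMeasure) (ae_of_all _ hpt)
    simp only [probReal_univ, mul_one] at h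
    calc ‖(1 / 2 : ℝ)‖ * _ ≤ ‖(1 / 2 : ℝ)‖ * (K * (2 * b i) ^ 2) := by gcongr
      _ = 2 * K * b i ^ 2 := by norm_num; ring
  have hle : ∀ n, s ≤ n → ‖∫ y, (u y - u (truncate s y)) ∂paramMeasure‖ ≤
      K * ∑' k, b (k + n) + 2 * K * T := by
    intro n hn
    have htel : ∫ y, (u y - u (truncate s y)) ∂paramMeasure =
        ∫ y, (u y - u (truncate n y)) ∂paramMeasure +
        ∑ i ∈ Finset.Ico s n, ∫ y, (u (truncate (i + 1) y) - u (truncate i y)) ∂paramMeasure := by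
      have h1 : ∀ i, ∫ y, (u (truncate (i + 1) y) - u (truncate i y)) ∂paramMeasure =
          ∫ y, u (truncate (i + 1) y) ∂paramMeasure - ∫ y, u (truncate i y) ∂paramMeasure :=
        fun i => integral_sub (hint (hcs _)) (hint (hcs _))
      simp only [h1]
      rw [Finset.sum_Ico_sub (fun i => ∫ y, u (truncate i y) ∂paramMeasure) hn,
        integral_sub (hint hcont) (hint (hcs _)), integral_sub (hint hcont) (hint (hcs _))]
      abel
    rw [htel]
    refine (norm_add_le _ _).trans (add_le_add ?_ ?_)
    · have h := norm_integral_le_of_norm_le_const (μ := paramMeasure)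
        (f := fun y => u y - u (truncate n y)) (C := K * ∑' k, b (k + n)) (ae_of_all _ fun y =>
          (hlip y (truncate n y)).trans
            (mul_le_mul_of_nonneg_left (signalDist_truncate_le hb0 hb n y) hK))
      simpa only [probReal_univ, mul_one] using h
    · calc _ ≤ ∑ i ∈ Finset.Ico s n, 2 * K * b i ^ 2 :=
          (norm_sum_le _ _).trans (Finset.sum_le_sum fun i _ => hstep i)
        _ = 2 * K * ∑ i ∈ Finset.Ico s n, b i ^ 2 := by rw [Finset.mul_sum]
        _ ≤ 2 * K * T := by gcongr; exact hT n
  have hlim : Filter.Tendsto (fun n => K * ∑' k, b (k + n) + 2 * K * T) Filter.atTop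
      (nhds (2 * K * T)) := by
    have := ((tendsto_sum_nat_add b).const_mul K).add_const (2 * K * T)
    simpa using this
  exact ge_of_tendsto hlim (Filter.eventually_atTop.2 ⟨s, hle⟩)

/-- Stechkin's estimate: the tail of the squares of a non-increasing `p`-summable sequence. -/
theorem exists_sum_sq_le_rpow {p : ℝ} (hp0 : 0 < p) (hp1 : p < 1) (hb0 : ∀ k, 0 ≤ b k)
    (hanti : Antitone b) (hp : Summable fun k => b k ^ p) :
    ∃ C, 0 ≤ C ∧ ∀ s : ℕ, 1 ≤ s → ∀ n, ∑ i ∈ Finset.Ico s n, b i ^ 2 ≤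
      C * (s : ℝ) ^ (-2 / p + 1) := by
  set S := ∑' k, b k ^ p
  have hbp : ∀ k, 0 ≤ b k ^ p := fun k => Real.rpow_nonneg (hb0 k) p
  have hS : 0 ≤ S := tsum_nonneg hbp
  refine ⟨S * S ^ ((2 - p) / p), by positivity, fun s hs n => ?_⟩
  have hs0 : (0 : ℝ) < s := by exact_mod_cast hs
  have hbs : b s ^ p ≤ S / s := by
    rw [le_div_iff₀ hs0]
    calc b s ^ p * s = ∑ _k ∈ Finset.range s, b s ^ p := by simp [mul_comm]
      _ ≤ ∑ k ∈ Finset.range s, b k ^ p := Finset.sum_le_sum fun k hk =>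
          Real.rpow_le_rpow (hb0 s) (hanti (Finset.mem_range.1 hk).le) hp0.le
      _ ≤ S := hp.sum_le_tsum _ fun k _ => hbp k
  have h2 : b s ^ (2 - p) ≤ (S / s) ^ ((2 - p) / p) := by
    have h3 : b s ^ (2 - p) = (b s ^ p) ^ ((2 - p) / p) := by
      rw [← Real.rpow_mul (hb0 s), mul_div_cancel₀ _ hp0.ne']
    rw [h3]
    exact Real.rpow_le_rpow (hbp s) hbs (div_nonneg (by linarith) hp0.le)
  calc ∑ i ∈ Finset.Ico s n, b i ^ 2 ≤ ∑ i ∈ Finset.Ico s n, b i ^ p * b s ^ (2 - p) := by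
        refine Finset.sum_le_sum fun i hi => ?_
        have h4 : b i ^ 2 = b i ^ p * b i ^ (2 - p) := by
          rw [← Real.rpow_add_of_nonneg (hb0 i) hp0.le (by linarith), ← Real.rpow_natCast]
          congr 1
          push_cast
          ring
        rw [h4]
        exact mul_le_mul_of_nonneg_left (Real.rpow_le_rpow (hb0 i)
          (hanti (Finset.mem_Ico.1 hi).1) (by linarith)) (hbp i)
    _ = (∑ i ∈ Finset.Ico s n, b i ^ p) * b s ^ (2 - p) := by rw [Finset.sum_mul]
    _ ≤ S * (S / s) ^ ((2 - p) / p) := mul_le_mul (hp.sum_le_tsum _ fun k _ => hbp k) h2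
        (Real.rpow_nonneg (hb0 s) _) hS
    _ = S * S ^ ((2 - p) / p) * (s : ℝ) ^ (-2 / p + 1) := by
        rw [Real.div_rpow hS hs0.le, div_eq_mul_inv, ← Real.rpow_neg hs0.le, mul_assoc]
        congr 3
        field_simp
        ring

end DomainUQ

namespace DomainUQ

variable {d : ℕ} {Dref : Set (EuclideanSpace ℝ (Fin d))}
  {ψ : ℕ → EuclideanSpace ℝ (Fin d) → EuclideanSpace ℝ (Fin d)}
  {f : EuclideanSpace ℝ (Fin d) → ℝ}

/-! ### The parametric transported problem -/

/-- `H01.grad` as a linear map. -/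
noncomputable def gradLinear (Ω : Set (EuclideanSpace ℝ (Fin d))) :
    H01 Ω →ₗ[ℝ] Lp (EuclideanSpace ℝ (Fin d)) 2 (volume.restrict Ω) where
  toFun := H01.grad
  map_add' _ _ := rfl
  map_smul' _ _ := rfl

/-- `H01.fn` as a linear map. -/
noncomputable def fnLinear (Ω : Set (EuclideanSpace ℝ (Fin d))) :
    H01 Ω →ₗ[ℝ] Lp ℝ 2 (volume.restrict Ω) where
  toFun := H01.fn
  map_add' _ _ := rfl
  map_smul' _ _ := rfl

/-- The transport coefficients and sources are bounded, uniformly elliptic, and have controlled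
first and second differences in the parameter. -/
theorem exists_bounds_transported_data (hΩ : IsOpen Dref) (hb : Bornology.IsBounded Dref)
    (hReg : FieldRegular Dref ψ) (hJac : JacobianUniformlyBounded Dref ψ)
    (hSum : FluctuationsSummable Dref ψ)
    (hf : AnalyticOnNhd ℝ f (closure (holdAll Dref ψ))) :
    ∃ c M : ℝ, 0 < c ∧ 0 ≤ M ∧
      (∀ y, BoundedOn Dref (fun x => coeffOfJacobian (fieldJet ψ y x).2) M ∧
        BoundedOn Dref (refSource ψ f y) M ∧
        ∀ x ∈ Dref, ∀ ξ : EuclideanSpace ℝ (Fin d), c * ‖ξ‖ ^ 2 ≤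
          (Matrix.of (coeffOfJacobian (fieldJet ψ y x).2) *ᵥ ξ.ofLp) ⬝ᵥ ξ.ofLp) ∧
      (∀ y₁ y₂ t, signalDist (fluctuationNorm Dref ψ) y₁ y₂ ≤ t → ∀ x ∈ Dref,
        ‖coeffOfJacobian (fieldJet ψ y₁ x).2 - coeffOfJacobian (fieldJet ψ y₂ x).2‖ ≤ M * t ∧
        ‖refSource ψ f y₁ x - refSource ψ f y₂ x‖ ≤ M * t) ∧
      ∀ y₀ y₁ y₂ t, (∀ k, signal y₁ k + signal y₂ k = 2 * signal y₀ k) →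
        signalDist (fluctuationNorm Dref ψ) y₁ y₂ ≤ t → ∀ x ∈ Dref,
        ‖coeffOfJacobian (fieldJet ψ y₁ x).2 + coeffOfJacobian (fieldJet ψ y₂ x).2 -
          (2 : ℝ) • coeffOfJacobian (fieldJet ψ y₀ x).2‖ ≤ M * t ^ 2 ∧
        ‖refSource ψ f y₁ x + refSource ψ f y₂ x - (2 : ℝ) • refSource ψ f y₀ x‖ ≤
          M * t ^ 2 := by
  obtain ⟨hKc, R, δ, hδ, hmem⟩ := exists_fieldJet_mem hΩ hb hReg hJac hSum
  have hK := hKc.prod (isCompact_boundedMatrices (d := d) R δ)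
  obtain ⟨c, hc, hell⟩ := exists_coercive_coeffOfJacobian (d := d) R hδ
  obtain ⟨A, hA, hA₀, hA₁, hA₂⟩ := exists_bound_comp_fieldJet hΩ hReg hSum hK hmem
    (h := fun w => coeffOfJacobian w.2) fun w hw =>
      (contDiffAt_coeffOfJacobian (hδ.trans_le hw.2.2).ne').comp w contDiffAt_snd
  obtain ⟨B, hB, hB₀, hB₁, hB₂⟩ := exists_bound_comp_fieldJet hΩ hReg hSum hK hmem
    (h := fun w => f w.1 * (Matrix.of w.2).det) fun w hw => contDiffAt_source hf hw.1
  have hAM : A ≤ max A B := le_max_left _ _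
  have hBM : B ≤ max A B := le_max_right _ _
  have hM : 0 ≤ max A B := hA.trans hAM
  have hdist := fun y₁ y₂ => signalDist_nonneg (b := fluctuationNorm Dref ψ)
    fluctuationNorm_nonneg y₁ y₂
  refine ⟨c, max A B, hc, hM, fun y => ⟨?_, ?_, fun x hx ξ => hell _ (hmem y x hx).2 ξ⟩,
    fun y₁ y₂ t ht x hx => ⟨?_, ?_⟩, fun y₀ y₁ y₂ t hy ht x hx => ⟨?_, ?_⟩⟩
  · exact ⟨(hA₀ y).meas, fun x hx => ((hA₀ y).bound x hx).trans hAM, hM⟩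
  · exact ⟨(hB₀ y).meas, fun x hx => ((hB₀ y).bound x hx).trans hBM, hM⟩
  · exact (hA₁ y₁ y₂ x hx).trans (mul_le_mul hAM ht (hdist y₁ y₂) hM)
  · exact (hB₁ y₁ y₂ x hx).trans (mul_le_mul hBM ht (hdist y₁ y₂) hM)
  · exact (hA₂ y₀ y₁ y₂ hy x hx).trans
      (mul_le_mul hAM (pow_le_pow_left₀ (hdist y₁ y₂) ht 2) (sq_nonneg _) hM)
  · exact (hB₂ y₀ y₁ y₂ hy x hx).trans
      (mul_le_mul hBM (pow_le_pow_left₀ (hdist y₁ y₂) ht 2) (sq_nonneg _) hM)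

end DomainUQ

theorem theorem4p1 (d : ℕ) (hd : d = 2 ∨ d = 3)
    (Dref : Set (EuclideanSpace ℝ (Fin d)))
    (hDref : DomainUQ.IsBoundedLipschitzDomain Dref)
    (ψ : ℕ → EuclideanSpace ℝ (Fin d) → EuclideanSpace ℝ (Fin d))
    (p : ℝ) (hp0 : 0 < p) (hp1 : p < 1)
    (hReg : DomainUQ.FieldRegular Dref ψ)
    (hC2 : DomainUQ.FieldUniformC2 Dref ψ)
    (hJac : DomainUQ.JacobianUniformlyBounded Dref ψ)
    (hSum : DomainUQ.FluctuationsSummable Dref ψ)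
    (hpSum : DomainUQ.FluctuationsPSummable Dref ψ p)
    (hOrd : DomainUQ.FluctuationsOrdered Dref ψ)
    (f : EuclideanSpace ℝ (Fin d) → ℝ)
    (hf : AnalyticOnNhd ℝ f (closure (DomainUQ.holdAll Dref ψ))) :
    (∀ y : DomainUQ.ParamSet, ∃! u : DomainUQ.H01 Dref,
      DomainUQ.IsWeakSolution Dref ψ f y u) ∧
    ∀ u : DomainUQ.ParamSet → DomainUQ.H01 Dref,
      (∀ y, DomainUQ.IsWeakSolution Dref ψ f y (u y)) →
      MeasureTheory.Integrable u DomainUQ.paramMeasure ∧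
      (∀ s : ℕ, MeasureTheory.Integrable (fun y => u (DomainUQ.truncate s y))
        DomainUQ.paramMeasure) ∧
      ∃ C : ℝ, ∀ s : ℕ, 1 ≤ s →
        DomainUQ.H01.h01Norm
            (∫ y, (u y - u (DomainUQ.truncate s y)) ∂DomainUQ.paramMeasure) ≤
          C * (s : ℝ) ^ (-2 / p + 1) ∧
        DomainUQ.H01.l1Norm
            (∫ y, (u y - u (DomainUQ.truncate s y)) ∂DomainUQ.paramMeasure) ≤
          C * (s : ℝ) ^ (-2 / p + 1) := by
  have hΩ := hDref.isOpen
  obtain ⟨c, M, hc, hM, hdata, hdiff₁, hdiff₂⟩ :=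
    DomainUQ.exists_bounds_transported_data hΩ hDref.isBounded hReg hJac hSum hf
  obtain ⟨P, hP, hpoin⟩ := DomainUQ.exists_poincare hd hDref.isBounded
  obtain ⟨C₁, hC₁, hl1⟩ := DomainUQ.exists_l1Norm_le hDref.isBounded
  have hpoin' : ∀ u : DomainUQ.H01 Dref,
      ‖u‖ ^ 2 ≤ (P ^ 2 + 1) * ‖DomainUQ.gradLinear Dref u‖ ^ 2 := by
    intro u
    have h := pow_le_pow_left₀ (norm_nonneg _) (hpoin u) 2
    rw [DomainUQ.norm_sq_eq_fn_add_grad]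
    change _ ≤ (P ^ 2 + 1) * ‖DomainUQ.H01.grad u‖ ^ 2
    linarith [mul_pow P ‖DomainUQ.H01.grad u‖ 2]
  refine ⟨fun y => ?_, fun u hu => ?_⟩
  · exact DomainUQ.existsUnique_weakSolution (G := DomainUQ.gradLinear Dref)
      (N := DomainUQ.fnLinear Dref) hΩ hc (by positivity) DomainUQ.norm_grad_le hpoin' hl1
      (hdata y).1 (hdata y).2.2 (hdata y).2.1
  have hsol : ∀ y, DomainUQ.IsEllipticSolution (DomainUQ.gradLinear Dref)
      (DomainUQ.fnLinear Dref) c M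
      (fun x => DomainUQ.coeffOfJacobian (DomainUQ.fieldJet ψ y x).2)
      (DomainUQ.refSource ψ f y) (u y) := fun y =>
    ⟨(hdata y).1, (hdata y).2.2, (hdata y).2.1, hu y⟩
  obtain ⟨K, hK, hK₁, hK₂⟩ := DomainUQ.exists_bound_differences_of_isEllipticSolution
    (G := DomainUQ.gradLinear Dref) (N := DomainUQ.fnLinear Dref) hΩ hc hM hM
    (by positivity : 0 < P ^ 2 + 1) hC₁ DomainUQ.norm_grad_le hpoin' hl1
  have hb0 : ∀ k, 0 ≤ DomainUQ.fluctuationNorm Dref ψ k := DomainUQ.fluctuationNorm_nonneg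
  obtain ⟨hint, hints, hmean⟩ := DomainUQ.norm_integral_sub_truncate_le hb0
    (DomainUQ.summable_fluctuationNorm hSum) (u := u) hK
    (fun y y' => hK₁ _ _ _ _ _ _ _ (DomainUQ.signalDist_nonneg hb0 y y') (hsol y) (hsol y')
      (fun x hx => (hdiff₁ y y' _ le_rfl x hx).1) (fun x hx => (hdiff₁ y y' _ le_rfl x hx).2))
    (fun y₀ y₁ y₂ t ht hy h₁ h₂ h₁₂ => hK₂ _ _ _ _ _ _ _ _ _ t ht (hsol y₀) (hsol y₁) (hsol y₂)
      (fun x hx => (hdiff₁ y₁ y₀ t h₁ x hx).1) (fun x hx => (hdiff₁ y₂ y₀ t h₂ x hx).1)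
      (fun x hx => (hdiff₁ y₁ y₀ t h₁ x hx).2) (fun x hx => (hdiff₁ y₂ y₀ t h₂ x hx).2)
      (fun x hx => (hdiff₂ y₀ y₁ y₂ t hy h₁₂ x hx).1)
      (fun x hx => (hdiff₂ y₀ y₁ y₂ t hy h₁₂ x hx).2))
  have hanti : Antitone (DomainUQ.fluctuationNorm Dref ψ) := fun i j hij =>
    ENNReal.toReal_mono (hSum.1 i).ne (hOrd hij)
  have hps : Summable fun k => DomainUQ.fluctuationNorm Dref ψ k ^ p := by
    simpa [DomainUQ.fluctuationNorm, ENNReal.toReal_rpow] using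
      ENNReal.summable_toReal (LT.lt.ne hpSum)
  obtain ⟨T, hT, htail⟩ := DomainUQ.exists_sum_sq_le_rpow hp0 hp1 hb0 hanti hps
  refine ⟨hint, hints, (1 + C₁) * (2 * K * T), fun s hs => ?_⟩
  have hw := hmean s _ (htail s hs)
  set w := ∫ y, (u y - u (DomainUQ.truncate s y)) ∂DomainUQ.paramMeasure
  have hr : (0 : ℝ) ≤ (s : ℝ) ^ (-2 / p + 1) := by positivity
  have hle : (1 + C₁) * ‖w‖ ≤ (1 + C₁) * (2 * K * T) * (s : ℝ) ^ (-2 / p + 1) := by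
    calc (1 + C₁) * ‖w‖ ≤ (1 + C₁) * (2 * K * (T * (s : ℝ) ^ (-2 / p + 1))) := by gcongr
      _ = _ := by ring
  constructor
  · refine (DomainUQ.norm_grad_le w).trans (le_trans ?_ hle)
    exact le_mul_of_one_le_left (norm_nonneg _) (by linarith)
  · refine (hl1 w).2.trans (le_trans ?_ hle)
    gcongr
    linarith
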